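/- Let $(R,\mathfrak m,k)$ be a commutative Noetherian local ring. For an $R$-module $M$ (not necessarily finitely generated) put $\operatorname{depth}_R M=\inf\{i\ge 0 : \operatorname{Ext}^i_R(k,M)\neq 0\}$, with $\inf\emptyset=\infty$. A finitely generated $R$-module $T$ is called totally reflexive if there is an exact complex $F=\cdots\to F_1\to F_0\to F_{-1}\to\cdots$ of finitely generated free $R$-modules such that $\operatorname{Hom}_R(F,R)$ is exact and $T\cong\operatorname{im}(F_0\to F_{-1})$. Let $s\ge 0$ be an integer and let $G=0\to G_s\to G_{s-1}\to\cdots\to G_0\to 0$ be a complex of totally reflexive $R$-modules which is not exact and all of whose homology modules have finite length. Assume that at least one of the following holds: (i) there exists an $R$-module $B$ such that $\operatorname{depth}_R B<\infty$ and $\operatorname{depth}_R(B\otimes_R T)\ge\dim R$ for every totally reflexive $R$-module $T$; (ii) $R$ is Cohen–Macaulay, i.e. $\operatorname{depth}_R R=\dim R$. Then $\dim R\le s$. -/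

import Mathlib

universe u

open CategoryTheory TensorProduct

noncomputable section

/-- The depth of an arbitrary module over a local ring with residue field `k`: the infimum of
the `i` with `Ext^i(k, M) ≠ 0`, equal to `⊤` if there is no such `i`. -/
def moduleDepth (R : Type u) [CommRing R] [IsLocalRing R]
    (M : Type u) [AddCommGroup M] [Module R M] : ℕ∞ :=
  ⨅ (i : ℕ) (_ : Nontrivial
    (Abelian.Ext (ModuleCat.of R (IsLocalRing.ResidueField R)) (ModuleCat.of R M) i)), (i : ℕ∞)

/-- A local ring is Cohen-Macaulay if its depth equals its Krull dimension
(used for Noetherian rings). -/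
def IsCohenMacaulayLocal (R : Type u) [CommRing R] [IsLocalRing R] : Prop :=
  ((moduleDepth R R : ℕ∞) : WithBot ℕ∞) = ringKrullDim R

/-- A finitely generated module `M` is totally reflexive if there is an exact complex `F`, indexed
by all integers, of finitely generated free modules such that `Hom(F, R)` is exact and `M` is
isomorphic to the image of `F_0 → F_{-1}`. -/
def IsTotallyReflexive (R : Type u) [CommRing R]
    (M : Type u) [AddCommGroup M] [Module R M] : Prop :=
  Module.Finite R M ∧
    ∃ F : ChainComplex (ModuleCat.{u} R) ℤ,
      (∀ n, Module.Free R (F.X n) ∧ Module.Finite R (F.X n)) ∧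
      F.Acyclic ∧
      (∀ n, Function.Exact (F.d n (n - 1)).hom.dualMap (F.d (n + 1) n).hom.dualMap) ∧
      Nonempty (M ≃ₗ[R] LinearMap.range (F.d 0 (-1)).hom)

end

/-! Suppose `s < dim R`; then `G` is shown to be exact. Either hypothesis gives a module `B` of
finite depth `t + 1 > s` with `Hom(k, B ⊗ T) = 0` for every totally reflexive `T`; in the
Cohen–Macaulay case `B = R` works, since `T` embeds in a free module.

Replace `G` by a complex `0 → W_s → E_s → ⋯ → E_1 → 0` with the same homology, `E_i` finite free and
`W_s` totally reflexive (`exists_free_resolution`). Since the homology has finite length, some power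
of each `x` in the maximal ideal is null-homotopic on it (`exists_homotopy_succ`). Hence that power,
acting on `W_s`, factors through a free module, and the dual complex also has torsion homology.

The crucial fact is `Ext^i(W_s^*, B) = 0` for `i > 0`. For `T = W_s` and its cosyzygies, the kernel
of `B ⊗ T → Hom(T^*, B)` is torsion because powers of `x` factor through free modules; as `B ⊗ T`
has positive depth, the map is injective. Dimension shifting along cosyzygies gives the vanishing
(`IsCosyzygyClosed.extVanish_dual`).

The dual complex thus has no higher `Ext` into `B` termwise, torsion homology, and length at most
`t`, while `Ext^j(k, B)` first becomes nonzero at `j = t + 1`. An acyclicity argument with `Ext`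
into `B` makes it exact (`dual_exact`). As `Ext^i(W_s^*, R) = 0` for `i > 0` and `W_s` is reflexive,
dualising once more preserves exactness (`exact_of_dual_exact`), so `G` is exact. -/

/-- Vanishing of `Ext^i_R(M, N)`. -/
def ExtVanish (R : Type u) [CommRing R] (M N : Type u) [AddCommGroup M] [Module R M]
    [AddCommGroup N] [Module R N] (i : ℕ) : Prop :=
  Subsingleton (Abelian.Ext (ModuleCat.of R M) (ModuleCat.of R N) i)

/-! ### Long exact sequences for `Ext` in the first variable -/

namespace ExtVanish

variable {R : Type u} [CommRing R] {A M C N : Type u}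
  [AddCommGroup A] [Module R A] [AddCommGroup M] [Module R M]
  [AddCommGroup C] [Module R C] [AddCommGroup N] [Module R N]

theorem shortExact_of_exact {f : A →ₗ[R] M} {g : M →ₗ[R] C} (hf : Function.Injective f)
    (hfg : Function.Exact f g) (hg : Function.Surjective g) :
    (ShortComplex.mk (ModuleCat.ofHom f) (ModuleCat.ofHom g)
      (by ext x; simpa using hfg.apply_apply_eq_zero x)).ShortExact :=
  { exact := (ShortComplex.ShortExact.moduleCat_exact_iff_function_exact _).2 hfg
    mono_f := (ModuleCat.mono_iff_injective _).2 hf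
    epi_g := (ModuleCat.epi_iff_surjective _).2 hg }

theorem congr_left (e : A ≃ₗ[R] M) {i : ℕ} (h : ExtVanish R A N i) : ExtVanish R M N i := by
  unfold ExtVanish at *
  refine ⟨fun a b => ?_⟩
  have key : ∀ a : Abelian.Ext (ModuleCat.of R M) (ModuleCat.of R N) i,
      a = (Abelian.Ext.mk₀ (ModuleCat.ofHom e.symm.toLinearMap)).comp
        ((Abelian.Ext.mk₀ (ModuleCat.ofHom e.toLinearMap)).comp a (zero_add i)) (zero_add i) := by
    intro a
    rw [Abelian.Ext.mk₀_comp_mk₀_assoc, ← ModuleCat.ofHom_comp]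
    simp
  rw [key a, key b, Subsingleton.elim ((Abelian.Ext.mk₀ (ModuleCat.ofHom e.toLinearMap)).comp a _)]

theorem congr_right (e : A ≃ₗ[R] M) {i : ℕ} (h : ExtVanish R N A i) : ExtVanish R N M i := by
  unfold ExtVanish at *
  refine ⟨fun a b => ?_⟩
  have key : ∀ a : Abelian.Ext (ModuleCat.of R N) (ModuleCat.of R M) i,
      a = (a.comp (Abelian.Ext.mk₀ (ModuleCat.ofHom e.symm.toLinearMap)) (add_zero i)).comp
        (Abelian.Ext.mk₀ (ModuleCat.ofHom e.toLinearMap)) (add_zero i) := by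
    intro a
    rw [Abelian.Ext.comp_assoc_of_third_deg_zero, Abelian.Ext.mk₀_comp_mk₀, ← ModuleCat.ofHom_comp]
    simp
  rw [key a, key b, Subsingleton.elim (a.comp _ _)]

theorem middle {f : A →ₗ[R] M} {g : M →ₗ[R] C} (hf : Function.Injective f)
    (hfg : Function.Exact f g) (hg : Function.Surjective g) {i : ℕ}
    (hA : ExtVanish R A N i) (hC : ExtVanish R C N i) :
    ExtVanish R M N i := by
  unfold ExtVanish at *
  rw [subsingleton_iff_forall_eq 0]
  intro x
  obtain ⟨y, rfl⟩ := Abelian.Ext.contravariant_sequence_exact₂ (shortExact_of_exact hf hfg hg) _ x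
    (hA.elim _ _)
  rw [hC.elim y 0]
  simp

theorem left {f : A →ₗ[R] M} {g : M →ₗ[R] C} (hf : Function.Injective f)
    (hfg : Function.Exact f g) (hg : Function.Surjective g) {i : ℕ}
    (hM : ExtVanish R M N i) (hC : ExtVanish R C N (i + 1)) :
    ExtVanish R A N i := by
  unfold ExtVanish at *
  rw [subsingleton_iff_forall_eq 0]
  intro x
  obtain ⟨y, rfl⟩ := Abelian.Ext.contravariant_sequence_exact₁ (shortExact_of_exact hf hfg hg) _ x
    (add_comm 1 i) (hC.elim _ _)
  rw [hM.elim y 0]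
  simp

theorem right {f : A →ₗ[R] M} {g : M →ₗ[R] C} (hf : Function.Injective f)
    (hfg : Function.Exact f g) (hg : Function.Surjective g) {i : ℕ}
    (hA : ExtVanish R A N i) (hM : ExtVanish R M N (i + 1)) :
    ExtVanish R C N (i + 1) := by
  unfold ExtVanish at *
  rw [subsingleton_iff_forall_eq 0]
  intro x
  obtain ⟨y, rfl⟩ := Abelian.Ext.contravariant_sequence_exact₃ (shortExact_of_exact hf hfg hg) _ x
    (hM.elim _ _) (add_comm 1 i)
  rw [hA.elim y 0]
  simp

theorem exists_extension {f : A →ₗ[R] M} {g : M →ₗ[R] C} (hf : Function.Injective f)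
    (hfg : Function.Exact f g) (hg : Function.Surjective g)
    (hC : ExtVanish R C N 1) (φ : A →ₗ[R] N) :
    ∃ ψ : M →ₗ[R] N, ψ ∘ₗ f = φ := by
  unfold ExtVanish at *
  obtain ⟨y, hy⟩ := Abelian.Ext.contravariant_sequence_exact₁ (shortExact_of_exact hf hfg hg)
    (ModuleCat.of R N) (Abelian.Ext.mk₀ (ModuleCat.ofHom φ)) (add_comm 1 0) (hC.elim _ _)
  obtain ⟨y, rfl⟩ := (Abelian.Ext.mk₀_bijective _ _).2 y
  rw [Abelian.Ext.mk₀_comp_mk₀] at hy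
  have := (Abelian.Ext.mk₀_bijective _ _).1 hy
  refine ⟨y.hom, ?_⟩
  exact congrArg ModuleCat.Hom.hom this

theorem one_of_forall_extension {f : A →ₗ[R] M} {g : M →ₗ[R] C} (hf : Function.Injective f)
    (hfg : Function.Exact f g) (hg : Function.Surjective g)
    (hM : ExtVanish R M N 1)
    (h : ∀ φ : A →ₗ[R] N, ∃ ψ : M →ₗ[R] N, ψ ∘ₗ f = φ) : ExtVanish R C N 1 := by
  unfold ExtVanish at *
  rw [subsingleton_iff_forall_eq 0]
  intro x
  obtain ⟨y, rfl⟩ := Abelian.Ext.contravariant_sequence_exact₃ (shortExact_of_exact hf hfg hg) _ x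
    (hM.elim _ _) (add_comm 1 0)
  obtain ⟨y, rfl⟩ := (Abelian.Ext.mk₀_bijective _ _).2 y
  obtain ⟨ψ, hψ⟩ := h y.hom
  have : y = ModuleCat.ofHom f ≫ ModuleCat.ofHom ψ := by
    ext1; simpa using hψ.symm
  rw [this, ← Abelian.Ext.mk₀_comp_mk₀]
  exact (shortExact_of_exact hf hfg hg).extClass_comp_assoc _

theorem of_free [Module.Free R M] (i : ℕ) : ExtVanish R M N (i + 1) := by
  have : Projective (ModuleCat.of R M) :=
    (IsProjective.iff_projective M).1 inferInstance
  exact Abelian.Ext.subsingleton_of_projective _ _ i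

theorem zero_iff : ExtVanish R M N 0 ↔ ∀ φ : M →ₗ[R] N, φ = 0 := by
  unfold ExtVanish
  rw [Abelian.Ext.homEquiv₀.subsingleton_congr, ModuleCat.homEquiv.subsingleton_congr]
  exact subsingleton_iff_forall_eq 0

theorem of_subsingleton [Subsingleton M] (i : ℕ) : ExtVanish R M N i := by
  cases i with
  | zero => exact zero_iff.2 fun φ => Subsingleton.elim _ _
  | succ i => exact of_free i

end ExtVanish

/-! ### Torsion modules and `Ext` from the residue field -/

section Torsion

variable {R : Type u} [CommRing R] [IsLocalRing R]

open IsLocalRing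

/-- Every element is killed by a power of every element of the maximal ideal. -/
def IsMaxTorsion (R : Type u) [CommRing R] [IsLocalRing R] (H : Type*) [AddCommGroup H]
    [Module R H] : Prop :=
  ∀ x ∈ maximalIdeal R, ∀ h : H, ∃ n : ℕ, x ^ n • h = 0

theorem maximalIdeal_eq_of_isMaxTorsion {p : Ideal R} (hp : p.IsPrime)
    (h : ∀ x ∈ maximalIdeal R, ∃ n : ℕ, x ^ n ∈ p) : p = maximalIdeal R :=
  le_antisymm (le_maximalIdeal hp.ne_top) fun x hx =>
    let ⟨_, hn⟩ := h x hx
    hp.mem_of_pow_mem _ hn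

theorem IsFiniteLength.exists_pow_smul_eq_zero {M : Type*} [AddCommGroup M] [Module R M]
    (h : IsFiniteLength R M) {x : R} (hx : x ∈ maximalIdeal R) :
    ∃ n : ℕ, ∀ m : M, x ^ n • m = 0 := by
  induction h with
  | of_subsingleton => exact ⟨0, fun m => Subsingleton.elim _ _⟩
  | @of_simple_quotient M _ _ N hs _ ih =>
    obtain ⟨n, hn⟩ := ih
    obtain ⟨I, hI, ⟨e⟩⟩ := isSimpleModule_iff_quot_maximal.1 hs
    obtain rfl := eq_maximalIdeal hI
    refine ⟨n + 1, fun m => ?_⟩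
    have hm : x • m ∈ N := by
      rw [← Submodule.Quotient.mk_eq_zero, Submodule.Quotient.mk_smul]
      apply e.injective
      rw [map_smul, map_zero]
      obtain ⟨r, hr⟩ := Submodule.Quotient.mk_surjective _ (e (Submodule.Quotient.mk m))
      rw [← hr, ← Submodule.Quotient.mk_smul, Submodule.Quotient.mk_eq_zero]
      exact Ideal.mul_mem_right _ _ hx
    rw [pow_succ, mul_smul]
    exact congrArg Subtype.val (hn ⟨_, hm⟩)

variable [IsNoetherianRing R]

/-- Take a prime filtration: torsion forces every prime that occurs to be maximal, so `H` is built
from copies of the residue field by extensions. -/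
theorem IsMaxTorsion.extVanish {N : Type u} [AddCommGroup N] [Module R N] {i : ℕ}
    (hk : ∀ j ≤ i, ExtVanish R (ResidueField R) N j) (H : Type u) [AddCommGroup H] [Module R H]
    [Module.Finite R H] : IsMaxTorsion R H → ExtVanish R H N i := by
  refine IsNoetherianRing.induction_on_isQuotientEquivQuotientPrime R (M := H) inferInstance
    (motive := fun H _ _ _ => IsMaxTorsion R H → ExtVanish R H N i) ?_ ?_ ?_
  · intro H _ _ _ _ _
    exact ExtVanish.of_subsingleton i
  · intro H _ _ _ p e hH
    have hp : p.asIdeal = maximalIdeal R := by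
      refine maximalIdeal_eq_of_isMaxTorsion p.2 fun x hx => ?_
      obtain ⟨n, hn⟩ := hH x hx (e.symm (Submodule.Quotient.mk 1))
      refine ⟨n, ?_⟩
      have h2 := congrArg e hn
      rw [map_smul, e.apply_symm_apply, map_zero, ← Submodule.Quotient.mk_smul,
        Submodule.Quotient.mk_eq_zero] at h2
      simpa using h2
    have e' : ResidueField R ≃ₗ[R] H :=
      (Submodule.quotEquivOfEq _ _ hp.symm).trans e.symm
    exact (hk i le_rfl).congr_left e'
  · intro N₁ _ _ _ N₂ _ _ _ N₃ _ _ _ f g hf hg hfg h₁ h₃ h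
    refine ExtVanish.middle hf hfg hg (h₁ ?_) (h₃ ?_)
    · intro x hx y
      obtain ⟨n, hn⟩ := h x hx (f y)
      exact ⟨n, hf (by simpa using hn)⟩
    · intro x hx y
      obtain ⟨y, rfl⟩ := hg y
      obtain ⟨n, hn⟩ := h x hx y
      exact ⟨n, by rw [← map_smul, hn, map_zero]⟩

/-- A nonzero `H` surjects onto `k` with torsion kernel `K`. As `Ext^t(K, N) = 0`, the group
`Ext^(t+1)(k, N)` embeds in `Ext^(t+1)(H, N)`, so the first nonvanishing degree of `k` detects `H`.
-/
theorem IsMaxTorsion.subsingleton_of_extVanish {N : Type u} [AddCommGroup N] [Module R N] {t : ℕ}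
    (hk : ∀ j ≤ t, ExtVanish R (ResidueField R) N j)
    (hk' : ¬ ExtVanish R (ResidueField R) N (t + 1)) {H : Type u} [AddCommGroup H] [Module R H]
    [Module.Finite R H] (hH : IsMaxTorsion R H) (h : ExtVanish R H N (t + 1)) :
    Subsingleton H := by
  by_contra hne
  rw [not_subsingleton_iff_nontrivial] at hne
  obtain ⟨K, hK⟩ := IsCoatomic.exists_coatom (α := Submodule R H)
  have hs : IsSimpleModule R (H ⧸ K) := isSimpleModule_iff_isCoatom.2 hK
  obtain ⟨I, hI, ⟨e⟩⟩ := isSimpleModule_iff_quot_maximal.1 hs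
  obtain rfl := eq_maximalIdeal hI
  refine hk' (ExtVanish.congr_left (A := H ⧸ K) e ?_)
  refine ExtVanish.right (f := K.subtype) (g := K.mkQ) K.subtype_injective
    (LinearMap.exact_subtype_mkQ K) K.mkQ_surjective ?_ h
  exact IsMaxTorsion.extVanish hk K fun x hx y => by
    obtain ⟨n, hn⟩ := hH x hx y
    exact ⟨n, Subtype.ext hn⟩

/-- The annihilator of a nonzero `b` lies in an associated prime of `M`, which must be maximal; this
embeds `k` in `M`. No finiteness of `M` is needed. -/
theorem IsMaxTorsion.eq_zero_of_extVanish {M : Type u} [AddCommGroup M] [Module R M]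
    (hM : ExtVanish R (ResidueField R) M 0) (b : M)
    (hb : ∀ x ∈ maximalIdeal R, ∃ n : ℕ, x ^ n • b = 0) : b = 0 := by
  by_contra hne
  obtain ⟨p, hp, hle⟩ := exists_le_isAssociatedPrime_of_isNoetherianRing R b hne
  have hpm : p = maximalIdeal R := maximalIdeal_eq_of_isMaxTorsion hp.isPrime fun x hx => by
    obtain ⟨n, hn⟩ := hb x hx
    exact ⟨n, hle (by simpa using hn)⟩
  obtain ⟨f, hf⟩ := (isAssociatedPrime_iff_exists_injective_linearMap _ _).1 hp |>.2
  subst hpm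
  have := ExtVanish.zero_iff.1 hM f
  have h1 : f 1 = f 0 := by rw [this]; rfl
  exact one_ne_zero (hf h1)

end Torsion

/-! ### Total reflexivity as closure under syzygies and cosyzygies -/

section FreeStep

variable {R : Type u} [CommRing R]

theorem LinearMap.exists_comp_eq_of_surjective {M N L : Type*} [AddCommGroup M] [Module R M]
    [AddCommGroup N] [Module R N] [AddCommGroup L] [Module R L] {p : M →ₗ[R] N}
    (hp : Function.Surjective p) (φ : M →ₗ[R] L) (h : ∀ w, p w = 0 → φ w = 0) :
    ∃ ψ : N →ₗ[R] L, ψ ∘ₗ p = φ := by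
  refine ⟨(LinearMap.ker p).liftQ φ (fun w hw => h w (LinearMap.mem_ker.1 hw)) ∘ₗ
    (p.quotKerEquivOfSurjective hp).symm.toLinearMap, LinearMap.ext fun w => ?_⟩
  have : (p.quotKerEquivOfSurjective hp).symm (p w) = Submodule.Quotient.mk w :=
    (LinearEquiv.symm_apply_eq _).2 rfl
  simp only [LinearMap.comp_apply, LinearEquiv.coe_coe, this]
  exact Submodule.liftQ_apply _ _ _

/-- There is a short exact sequence `0 → A → F → B → 0` with `F` finitely generated free, which
stays exact under `Hom(-, R)`. -/
def FreeStep (A B : ModuleCat.{u} R) : Prop :=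
  ∃ (F : ModuleCat.{u} R) (i : A →ₗ[R] F) (p : F →ₗ[R] B), Module.Free R F ∧ Module.Finite R F ∧
    Function.Injective i ∧ Function.Exact i p ∧ Function.Surjective p ∧
    Function.Surjective i.dualMap

/-- A class of modules in which every module has a syzygy and a cosyzygy with respect to
`FreeStep`. -/
structure IsStepClosed (P : ModuleCat.{u} R → Prop) : Prop where
  exists_syzygy : ∀ T, P T → ∃ K, P K ∧ FreeStep K T
  exists_cosyzygy : ∀ T, P T → ∃ C, P C ∧ FreeStep T C

theorem FreeStep.congr {A B A' B' : ModuleCat.{u} R} (e : A ≃ₗ[R] A') (e' : B ≃ₗ[R] B')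
    (h : FreeStep A B) : FreeStep A' B' := by
  obtain ⟨F, i, p, h1, h2, h3, h4, h5, h6⟩ := h
  refine ⟨F, i ∘ₗ e.symm.toLinearMap, e'.toLinearMap ∘ₗ p, h1, h2, ?_, ?_, ?_, ?_⟩
  · exact h3.comp e.symm.injective
  · intro y
    constructor
    · intro hy
      obtain ⟨a, rfl⟩ := (h4 y).1 (e'.injective (by simpa using hy))
      exact ⟨e a, by simp⟩
    · rintro ⟨a, rfl⟩
      simp [h4.apply_apply_eq_zero]
  · exact e'.surjective.comp h5
  · intro φ
    obtain ⟨ψ, hψ⟩ := h6 (φ ∘ₗ e.toLinearMap)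
    refine ⟨ψ, LinearMap.ext fun a => ?_⟩
    have := LinearMap.congr_fun hψ (e.symm a)
    simpa using this

theorem FreeStep.finite {A B : ModuleCat.{u} R} (h : FreeStep A B) : Module.Finite R B := by
  obtain ⟨F, i, p, h1, h2, h3, h4, h5, h6⟩ := h
  exact Module.Finite.of_surjective p h5

theorem FreeStep.extVanish {A B : ModuleCat.{u} R} (h : FreeStep A B) : ExtVanish R B R 1 := by
  obtain ⟨F, i, p, h1, h2, h3, h4, h5, h6⟩ := h
  refine ExtVanish.one_of_forall_extension h3 h4 h5 (ExtVanish.of_free 0) fun φ => ?_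
  obtain ⟨ψ, hψ⟩ := h6 φ
  exact ⟨ψ, hψ⟩

theorem freeStep_range {X Y Z W : ModuleCat.{u} R} (a : X →ₗ[R] Y) (b : Y →ₗ[R] Z)
    (c : Z →ₗ[R] W) [Module.Free R Z] [Module.Finite R Z] (hab : Function.Exact a b)
    (hbc : Function.Exact b c) (hd : Function.Exact b.dualMap a.dualMap) :
    FreeStep (ModuleCat.of R (LinearMap.range b)) (ModuleCat.of R (LinearMap.range c)) := by
  refine ⟨Z, (LinearMap.range b).subtype, c.rangeRestrict, inferInstance, inferInstance,
    Subtype.val_injective, ?_, c.surjective_rangeRestrict, ?_⟩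
  · intro z
    rw [← LinearMap.mem_ker, LinearMap.ker_rangeRestrict, LinearMap.mem_ker, hbc z]
    simp
  · intro φ
    obtain ⟨ψ, hψ⟩ := (hd (φ ∘ₗ b.rangeRestrict)).1 (by
      ext x
      have : b.rangeRestrict (a x) = 0 := Subtype.ext (hab.apply_apply_eq_zero x)
      simp [this])
    refine ⟨ψ, LinearMap.ext ?_⟩
    rintro ⟨_, y, rfl⟩
    exact LinearMap.congr_fun hψ y

theorem exists_int_sequence {α : Type*} (r : α → α → Prop) (P : α → Prop)
    (h1 : ∀ a, P a → ∃ b, P b ∧ r b a) (h2 : ∀ a, P a → ∃ b, P b ∧ r a b) (a : α) (ha : P a) :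
    ∃ T : ℤ → α, T 0 = a ∧ ∀ n, r (T (n + 1)) (T n) := by
  choose f hfP hf using h1
  choose g hgP hg using h2
  let up : ℕ → {a // P a} := fun n => Nat.rec ⟨a, ha⟩ (fun _ b => ⟨f b.1 b.2, hfP _ _⟩) n
  let down : ℕ → {a // P a} := fun n => Nat.rec ⟨a, ha⟩ (fun _ b => ⟨g b.1 b.2, hgP _ _⟩) n
  let T : ℤ → α := fun n => match n with
    | Int.ofNat n => (up n).1
    | Int.negSucc n => (down (n + 1)).1
  refine ⟨T, rfl, fun n => ?_⟩
  match n with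
  | Int.ofNat n => exact hf (up n).1 (up n).2
  | Int.negSucc 0 => exact hg a ha
  | Int.negSucc (n + 1) => exact hg (down (n + 1)).1 (down (n + 1)).2

/-- Splicing the steps in both directions gives a complete resolution. This reduces total
reflexivity to exhibiting a class of modules with one-step syzygies and cosyzygies. -/
theorem IsStepClosed.isTotallyReflexive {P : ModuleCat.{u} R → Prop} (hP : IsStepClosed P)
    {T : ModuleCat.{u} R} (hT : P T) : IsTotallyReflexive R T := by
  obtain ⟨K, -, hK⟩ := hP.exists_syzygy T hT
  refine ⟨hK.finite, ?_⟩
  obtain ⟨S, rfl, hS⟩ := exists_int_sequence FreeStep P hP.exists_syzygy hP.exists_cosyzygy T hT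
  choose F i p h1 h2 h3 h4 h5 h6 using hS
  let d : ∀ n, F (n + 1) ⟶ F n := fun n => ModuleCat.ofHom (i n ∘ₗ p (n + 1))
  have hd : ∀ n, d (n + 1) ≫ d n = 0 := by
    intro n
    ext x
    simp [d, (h4 (n + 1)).apply_apply_eq_zero]
  let C : ChainComplex (ModuleCat.{u} R) ℤ := ChainComplex.of F d hd
  have hC : ∀ n, (C.d (n + 1) n).hom = i n ∘ₗ p (n + 1) := fun n => by
    simp only [C, ChainComplex.of_d]
    rfl
  refine ⟨C, fun n => ⟨h1 n, h2 n⟩, ?_, ?_, ?_⟩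
  · intro n
    obtain ⟨n, rfl⟩ : ∃ m, n = m + 1 := ⟨n - 1, by simp⟩
    rw [HomologicalComplex.exactAt_iff' C (n + 1 + 1) (n + 1) n (by simp) (by simp),
      ShortComplex.ShortExact.moduleCat_exact_iff_function_exact]
    change Function.Exact (C.d (n + 1 + 1) (n + 1)).hom (C.d (n + 1) n).hom
    rw [hC, hC]
    intro y
    constructor
    · intro hy
      obtain ⟨z, rfl⟩ := (h4 (n + 1) y).1 (h3 n (by simpa using hy))
      obtain ⟨w, rfl⟩ := h5 (n + 1 + 1) z
      exact ⟨w, rfl⟩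
    · rintro ⟨w, rfl⟩
      simp [(h4 (n + 1)).apply_apply_eq_zero]
  · have key : ∀ a b c : ℤ, a = b + 1 → b = c + 1 →
        Function.Exact (C.d b c).hom.dualMap (C.d a b).hom.dualMap := by
      rintro _ _ c rfl rfl
      rw [hC, hC]
      intro φ
      constructor
      · intro hφ
        have hφ' : ∀ z, φ (i (c + 1) z) = 0 := fun z => by
          obtain ⟨w, rfl⟩ := h5 (c + 1 + 1) z
          exact LinearMap.congr_fun hφ w
        obtain ⟨ψ, hψ⟩ := LinearMap.exists_comp_eq_of_surjective (h5 (c + 1)) φ fun w hw => by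
          obtain ⟨z, rfl⟩ := (h4 (c + 1) w).1 hw
          exact hφ' z
        obtain ⟨χ, rfl⟩ := h6 c ψ
        exact ⟨χ, hψ⟩
      · rintro ⟨χ, rfl⟩
        ext w
        have : p (c + 1) (i (c + 1) (p (c + 1 + 1) w)) = 0 := (h4 (c + 1)).apply_apply_eq_zero _
        change χ (i c (p (c + 1) (i (c + 1) (p (c + 1 + 1) w)))) = 0
        rw [this, map_zero, map_zero]
    exact fun n => key _ _ _ rfl (by simp)
  · have key : ∀ a, a = (-1 : ℤ) + 1 → Nonempty (S a ≃ₗ[R] LinearMap.range (C.d a (-1)).hom) := by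
      rintro _ rfl
      rw [hC]
      refine ⟨(LinearEquiv.ofInjective (i (-1)) (h3 (-1))).trans (LinearEquiv.ofEq _ _ ?_)⟩
      rw [LinearMap.range_comp, LinearMap.range_eq_top.2 (h5 (-1 + 1)), Submodule.map_top]
    exact key 0 (by norm_num)

theorem isStepClosed_of_complex (F : ChainComplex (ModuleCat.{u} R) ℤ)
    (hF : ∀ n, Module.Free R (F.X n) ∧ Module.Finite R (F.X n)) (hac : F.Acyclic)
    (hd : ∀ n, Function.Exact (F.d n (n - 1)).hom.dualMap (F.d (n + 1) n).hom.dualMap) :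
    IsStepClosed fun T : ModuleCat.{u} R =>
      ∃ a b : ℤ, a = b + 1 ∧ Nonempty (T ≃ₗ[R] LinearMap.range (F.d a b).hom) := by
  have hex : ∀ n : ℤ, Function.Exact (F.d (n + 1 + 1) (n + 1)).hom (F.d (n + 1) n).hom := by
    intro n
    have := hac (n + 1)
    rwa [HomologicalComplex.exactAt_iff' F (n + 1 + 1) (n + 1) n (by simp) (by simp),
      ShortComplex.ShortExact.moduleCat_exact_iff_function_exact] at this
  have hde : ∀ n : ℤ, Function.Exact (F.d (n + 1) n).hom.dualMap
      (F.d (n + 1 + 1) (n + 1)).hom.dualMap := by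
    intro n
    have := hd (n + 1)
    rwa [add_sub_cancel_right] at this
  have step : ∀ n : ℤ, FreeStep (ModuleCat.of R (LinearMap.range (F.d (n + 1 + 1) (n + 1)).hom))
      (ModuleCat.of R (LinearMap.range (F.d (n + 1) n).hom)) := by
    intro n
    have := (hF (n + 1)).1
    have := (hF (n + 1)).2
    exact freeStep_range _ _ _ (hex (n + 1)) (hex n) (hde (n + 1))
  constructor
  · rintro T ⟨_, b, rfl, ⟨e⟩⟩
    exact ⟨_, ⟨b + 1 + 1, b + 1, rfl, ⟨LinearEquiv.refl _ _⟩⟩,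
      (step b).congr (LinearEquiv.refl _ _) e.symm⟩
  · rintro T ⟨_, b, rfl, ⟨e⟩⟩
    obtain ⟨n, rfl⟩ : ∃ m, b = m + 1 := ⟨b - 1, by simp⟩
    exact ⟨_, ⟨n + 1, n, rfl, ⟨LinearEquiv.refl _ _⟩⟩,
      (step n).congr e.symm (LinearEquiv.refl _ _)⟩

theorem isStepClosed_isTotallyReflexive :
    IsStepClosed fun T : ModuleCat.{u} R => IsTotallyReflexive R T := by
  constructor
  · rintro T ⟨-, F, hF, hac, hd, ⟨e⟩⟩
    have hc := isStepClosed_of_complex F hF hac hd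
    obtain ⟨K, hK, h⟩ := hc.exists_syzygy T ⟨0, -1, rfl, ⟨e⟩⟩
    exact ⟨K, hc.isTotallyReflexive hK, h⟩
  · rintro T ⟨-, F, hF, hac, hd, ⟨e⟩⟩
    have hc := isStepClosed_of_complex F hF hac hd
    obtain ⟨K, hK, h⟩ := hc.exists_cosyzygy T ⟨0, -1, rfl, ⟨e⟩⟩
    exact ⟨K, hc.isTotallyReflexive hK, h⟩

theorem isTotallyReflexive_of_free (T : ModuleCat.{u} R) [Module.Free R T] [Module.Finite R T] :
    IsTotallyReflexive R T := by
  refine IsStepClosed.isTotallyReflexive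
    (P := fun T : ModuleCat.{u} R => Module.Free R T ∧ Module.Finite R T) ?_
    ⟨inferInstance, inferInstance⟩
  constructor
  · rintro T ⟨h1, h2⟩
    refine ⟨ModuleCat.of R PUnit, ⟨inferInstance, inferInstance⟩, T, 0, LinearMap.id, h1, h2,
      Function.injective_of_subsingleton _, ?_, Function.surjective_id,
      fun φ => ⟨0, LinearMap.ext fun x => by
        rw [Subsingleton.elim (α := PUnit) x 0]
        exact (map_zero _).trans (map_zero φ).symm⟩⟩
    intro x
    simp [eq_comm]
  · rintro T ⟨h1, h2⟩
    refine ⟨ModuleCat.of R PUnit, ⟨inferInstance, inferInstance⟩, T, LinearMap.id, 0, h1, h2,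
      Function.injective_id, ?_, fun _ => ⟨0, Subsingleton.elim (α := PUnit) _ _⟩,
      fun φ => ⟨φ, rfl⟩⟩
    intro x
    simp

theorem exists_extension_to_free {A M F : Type*} [AddCommGroup A] [Module R A]
    [AddCommGroup M] [Module R M] [AddCommGroup F] [Module R F] [Module.Free R F]
    [Module.Finite R F] {i : A →ₗ[R] M} (hi : Function.Surjective i.dualMap) (f : A →ₗ[R] F) :
    ∃ g : M →ₗ[R] F, g ∘ₗ i = f := by
  let b := Module.Free.chooseBasis R F
  choose g hg using fun j => hi (b.coord j ∘ₗ f)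
  refine ⟨b.equivFun.symm.toLinearMap ∘ₗ LinearMap.pi g, LinearMap.ext fun a => ?_⟩
  rw [LinearMap.comp_apply, LinearMap.comp_apply, LinearEquiv.coe_coe, LinearEquiv.symm_apply_eq]
  ext j
  exact LinearMap.congr_fun (hg j) a

end FreeStep

/-! ### Extensions of totally reflexive modules -/

namespace IsTotallyReflexive

variable {R : Type u} [CommRing R]

theorem congr {A M : Type u} [AddCommGroup A] [Module R A] [AddCommGroup M] [Module R M]
    (e : A ≃ₗ[R] M) (h : IsTotallyReflexive R A) : IsTotallyReflexive R M := by
  obtain ⟨h1, F, hF, hac, hd, ⟨e'⟩⟩ := h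
  exact ⟨Module.Finite.equiv e, F, hF, hac, hd, ⟨e.symm.trans e'⟩⟩

theorem extVanish {T : Type u} [AddCommGroup T] [Module R T] (h : IsTotallyReflexive R T) :
    ExtVanish R T R 1 := by
  obtain ⟨K, -, hK⟩ := isStepClosed_isTotallyReflexive.exists_syzygy (ModuleCat.of R T) h
  exact hK.extVanish

theorem exists_cover {T : Type u} [AddCommGroup T] [Module R T] (h : IsTotallyReflexive R T) :
    ∃ (F : ModuleCat.{u} R) (p : F →ₗ[R] T), Module.Free R F ∧ Module.Finite R F ∧
      Function.Surjective p ∧ IsTotallyReflexive R (LinearMap.ker p) := by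
  obtain ⟨K, hK, F, i, p, h1, h2, h3, h4, h5, h6⟩ :=
    isStepClosed_isTotallyReflexive.exists_syzygy (ModuleCat.of R T) h
  refine ⟨F, p, h1, h2, h5, hK.congr ?_⟩
  exact (LinearEquiv.ofInjective i h3).trans (LinearEquiv.ofEq _ _ h4.linearMap_ker_eq.symm)

theorem exists_embedding {T : Type u} [AddCommGroup T] [Module R T]
    (h : IsTotallyReflexive R T) :
    ∃ (F : ModuleCat.{u} R) (i : T →ₗ[R] F), Module.Free R F ∧ Module.Finite R F ∧
      Function.Injective i ∧ Function.Surjective i.dualMap ∧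
      IsTotallyReflexive R (F ⧸ LinearMap.range i) := by
  obtain ⟨C, hC, F, i, p, h1, h2, h3, h4, h5, h6⟩ :=
    isStepClosed_isTotallyReflexive.exists_cosyzygy (ModuleCat.of R T) h
  refine ⟨F, i, h1, h2, h3, h6, hC.congr ?_⟩
  exact ((Submodule.quotEquivOfEq _ _ h4.linearMap_ker_eq.symm).trans
    (p.quotKerEquivOfSurjective h5)).symm

theorem freeStep_ker {F T : ModuleCat.{u} R} [Module.Free R F] [Module.Finite R F]
    (p : F →ₗ[R] T) (hp : Function.Surjective p) (hT : ExtVanish R T R 1) :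
    FreeStep (ModuleCat.of R (LinearMap.ker p)) T :=
  ⟨F, (LinearMap.ker p).subtype, p, inferInstance, inferInstance, Subtype.val_injective,
    LinearMap.exact_subtype_ker_map p, hp, fun φ =>
    ExtVanish.exists_extension (f := (LinearMap.ker p).subtype) (g := p) Subtype.val_injective
      (LinearMap.exact_subtype_ker_map p) hp hT φ⟩

theorem freeStep_coker {T F : ModuleCat.{u} R} [Module.Free R F] [Module.Finite R F]
    (i : T →ₗ[R] F) (hi : Function.Injective i) (hd : Function.Surjective i.dualMap) :
    FreeStep T (ModuleCat.of R (F ⧸ LinearMap.range i)) :=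
  ⟨F, i, (LinearMap.range i).mkQ, inferInstance, inferInstance, hi,
    LinearMap.exact_map_mkQ_range i, Submodule.mkQ_surjective _, hd⟩

/-- The class of extensions of totally reflexive modules by totally reflexive modules. -/
def IsExtension (M : ModuleCat.{u} R) : Prop :=
  ∃ (A C : ModuleCat.{u} R) (f : A →ₗ[R] M) (g : M →ₗ[R] C), IsTotallyReflexive R A ∧
    IsTotallyReflexive R C ∧ Function.Injective f ∧ Function.Exact f g ∧ Function.Surjective g

theorem isExtension_exists_syzygy (M : ModuleCat.{u} R) (h : IsExtension M) :
    ∃ K, IsExtension K ∧ FreeStep K M := by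
  obtain ⟨A, C, f, g, hA, hC, hf, hfg, hg⟩ := h
  obtain ⟨F₁, p₁, _, _, hp₁, hK₁⟩ := hA.exists_cover
  obtain ⟨F₂, p₂, _, _, hp₂, hK₂⟩ := hC.exists_cover
  obtain ⟨q, hq⟩ := Module.projective_lifting_property g p₂ hg
  have hq' : ∀ x, g (q x) = p₂ x := LinearMap.congr_fun hq
  -- Horseshoe construction: the kernel of `p` is an extension of `ker p₂` by `ker p₁`.
  let p : F₁ × F₂ →ₗ[R] M := (f ∘ₗ p₁).coprod q
  have hpx : ∀ x, p x = f (p₁ x.1) + q x.2 := fun x => rfl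
  have hgp : ∀ x, g (p x) = p₂ x.2 := fun x => by
    rw [hpx, map_add, hfg.apply_apply_eq_zero, hq', zero_add]
  have hp : Function.Surjective p := by
    intro m
    obtain ⟨b, hb⟩ := hp₂ (g m)
    obtain ⟨a, ha⟩ := (hfg (m - q b)).1 (by rw [map_sub, hq', hb, sub_self])
    obtain ⟨a, rfl⟩ := hp₁ a
    exact ⟨(a, b), by rw [hpx, ha]; simp⟩
  have hM : ExtVanish R M R 1 := ExtVanish.middle hf hfg hg hA.extVanish hC.extVanish
  refine ⟨ModuleCat.of R (LinearMap.ker p), ?_, freeStep_ker (F := ModuleCat.of R (F₁ × F₂)) p hp hM⟩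
  let a : LinearMap.ker p₁ →ₗ[R] LinearMap.ker p :=
    (LinearMap.inl R F₁ F₂).restrict fun x (hx : p₁ x = 0) => by
      rw [LinearMap.mem_ker, hpx]
      simp [hx]
  let c : LinearMap.ker p →ₗ[R] LinearMap.ker p₂ :=
    (LinearMap.snd R F₁ F₂).restrict fun x (hx : p x = 0) => by
      rw [LinearMap.mem_ker, LinearMap.snd_apply, ← hgp, hx, map_zero]
  refine ⟨ModuleCat.of R (LinearMap.ker p₁), ModuleCat.of R (LinearMap.ker p₂), a, c, hK₁, hK₂,
    ?_, ?_, ?_⟩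
  · intro x y hxy
    have : (a x).1.1 = (a y).1.1 := by rw [hxy]
    exact Subtype.ext this
  · rintro ⟨⟨x, y⟩, hxy⟩
    constructor
    · intro hy
      have hy : y = 0 := congrArg Subtype.val hy
      subst hy
      have : f (p₁ x) = 0 := by
        have h2 : p (x, 0) = 0 := hxy
        rw [hpx] at h2
        simpa using h2
      exact ⟨⟨x, hf (by rw [this, map_zero])⟩, rfl⟩
    · rintro ⟨z, hz⟩
      rw [← hz]
      rfl
  · rintro ⟨y, hy : p₂ y = 0⟩
    obtain ⟨x, hx⟩ := (hfg (q y)).1 (by rw [hq', hy])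
    obtain ⟨x, rfl⟩ := hp₁ x
    refine ⟨⟨(-x, y), ?_⟩, rfl⟩
    rw [LinearMap.mem_ker, hpx, ← hx]
    simp

theorem isExtension_exists_cosyzygy (M : ModuleCat.{u} R) (h : IsExtension M) :
    ∃ C, IsExtension C ∧ FreeStep M C := by
  obtain ⟨A, C, f, g, hA, hC, hf, hfg, hg⟩ := h
  obtain ⟨F₁, i₁, _, _, hi₁, hd₁, hK₁⟩ := hA.exists_embedding
  obtain ⟨F₂, i₂, _, _, hi₂, hd₂, hK₂⟩ := hC.exists_embedding
  -- Dual horseshoe: `i₁` extends from `A` to `M` because `Ext^1(C, R) = 0`.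
  obtain ⟨j, hj⟩ := exists_extension_to_free (i := f)
    (fun φ => ExtVanish.exists_extension hf hfg hg hC.extVanish φ) i₁
  have hj' : ∀ x, j (f x) = i₁ x := LinearMap.congr_fun hj
  let i : M →ₗ[R] F₁ × F₂ := j.prod (i₂ ∘ₗ g)
  have hix : ∀ x, i x = (j x, i₂ (g x)) := fun x => rfl
  have hi : Function.Injective i := by
    rw [injective_iff_map_eq_zero]
    intro m hm
    rw [hix, Prod.mk_eq_zero] at hm
    obtain ⟨a, rfl⟩ := (hfg m).1 (hi₂ (by rw [hm.2, map_zero]))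
    rw [hj'] at hm
    rw [hi₁ (hm.1.trans (map_zero _).symm), map_zero]
  have hd : Function.Surjective i.dualMap := by
    intro φ
    obtain ⟨ψ, hψ⟩ := hd₁ (φ ∘ₗ f)
    have hψ' : ∀ a, ψ (i₁ a) = φ (f a) := LinearMap.congr_fun hψ
    obtain ⟨χ, hχ⟩ := LinearMap.exists_comp_eq_of_surjective hg (φ - ψ ∘ₗ j) (fun m hm => by
      obtain ⟨a, rfl⟩ := (hfg m).1 hm
      simp [hj', hψ'])
    obtain ⟨ξ, hξ⟩ := hd₂ χ
    refine ⟨ψ.coprod ξ, LinearMap.ext fun m => ?_⟩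
    have h1 : ξ (i₂ (g m)) = χ (g m) := LinearMap.congr_fun hξ _
    have h2 : χ (g m) = φ m - ψ (j m) := LinearMap.congr_fun hχ m
    change ψ (j m) + ξ (i₂ (g m)) = φ m
    rw [h1, h2]
    abel
  refine ⟨ModuleCat.of R ((F₁ × F₂) ⧸ LinearMap.range i), ?_,
    freeStep_coker (F := ModuleCat.of R (F₁ × F₂)) i hi hd⟩
  let a : (F₁ ⧸ LinearMap.range i₁) →ₗ[R] (F₁ × F₂) ⧸ LinearMap.range i :=
    Submodule.mapQ _ _ (LinearMap.inl R F₁ F₂) (by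
      rintro _ ⟨x, rfl⟩
      exact ⟨f x, by rw [hix, hj', hfg.apply_apply_eq_zero, map_zero]; rfl⟩)
  let c : ((F₁ × F₂) ⧸ LinearMap.range i) →ₗ[R] F₂ ⧸ LinearMap.range i₂ :=
    Submodule.mapQ _ _ (LinearMap.snd R F₁ F₂) (by
      rintro _ ⟨x, rfl⟩
      exact ⟨g x, rfl⟩)
  refine ⟨ModuleCat.of R (F₁ ⧸ LinearMap.range i₁), ModuleCat.of R (F₂ ⧸ LinearMap.range i₂),
    a, c, hK₁, hK₂, ?_, ?_, ?_⟩
  · rw [injective_iff_map_eq_zero]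
    intro x hx
    obtain ⟨x, rfl⟩ := Submodule.mkQ_surjective _ x
    obtain ⟨m, hm⟩ : LinearMap.inl R F₁ F₂ x ∈ LinearMap.range i :=
      (Submodule.Quotient.mk_eq_zero _).1 hx
    have h1 : j m = x := congrArg Prod.fst hm
    have h2 : i₂ (g m) = 0 := congrArg Prod.snd hm
    obtain ⟨y, rfl⟩ := (hfg m).1 (hi₂ (by rw [h2, map_zero]))
    refine (Submodule.Quotient.mk_eq_zero _).2 ⟨y, ?_⟩
    rw [← h1, hj']
  · intro x
    obtain ⟨⟨x, y⟩, rfl⟩ := Submodule.mkQ_surjective _ x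
    constructor
    · intro hxy
      obtain ⟨z, hz⟩ : y ∈ LinearMap.range i₂ := (Submodule.Quotient.mk_eq_zero _).1 hxy
      obtain ⟨m, rfl⟩ := hg z
      refine ⟨Submodule.Quotient.mk (x - j m), ?_⟩
      refine (Submodule.Quotient.eq _).2 ⟨-m, ?_⟩
      rw [map_neg, hix, hz]
      simp
    · rintro ⟨z, hz⟩
      rw [← hz]
      obtain ⟨z, rfl⟩ := Submodule.mkQ_surjective _ z
      rfl
  · intro y
    obtain ⟨y, rfl⟩ := Submodule.mkQ_surjective _ y
    exact ⟨Submodule.Quotient.mk (0, y), rfl⟩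

theorem of_extension {A M C : Type u} [AddCommGroup A] [Module R A] [AddCommGroup M] [Module R M]
    [AddCommGroup C] [Module R C] {f : A →ₗ[R] M} {g : M →ₗ[R] C} (hA : IsTotallyReflexive R A)
    (hC : IsTotallyReflexive R C) (hf : Function.Injective f) (hfg : Function.Exact f g)
    (hg : Function.Surjective g) : IsTotallyReflexive R M :=
  IsStepClosed.isTotallyReflexive (T := ModuleCat.of R M) (P := IsExtension)
    ⟨isExtension_exists_syzygy, isExtension_exists_cosyzygy⟩
    ⟨ModuleCat.of R A, ModuleCat.of R C, f, g, hA, hC, hf, hfg, hg⟩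

end IsTotallyReflexive

/-! ### The evaluation map from `C ⊗ T` to `Hom(T^*, C)` -/

section Contraction

variable {R : Type u} [CommRing R]

/-- The canonical map `C ⊗ T → Hom(T^*, C)`. -/
def tensorEval (R : Type u) [CommRing R] (C T : Type*) [AddCommGroup C] [Module R C]
    [AddCommGroup T] [Module R T] : C ⊗[R] T →ₗ[R] Module.Dual R T →ₗ[R] C :=
  TensorProduct.lift (LinearMap.mk₂ R
    (fun c t => LinearMap.toSpanSingleton R C c ∘ₗ Module.Dual.eval R T t)
    (fun c c' t => by ext; simp) (fun r c t => by ext l; exact smul_comm (l t) r c)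
    (fun c t t' => by ext; simp [add_smul]) (fun r c t => by ext; simp [mul_smul]))

variable {C T F : Type*} [AddCommGroup C] [Module R C] [AddCommGroup T] [Module R T]
  [AddCommGroup F] [Module R F]

theorem tensorEval_tmul (c : C) (t : T) (l : Module.Dual R T) :
    tensorEval R C T (c ⊗ₜ t) l = l t • c := rfl

theorem tensorEval_lTensor (f : T →ₗ[R] F) (z : C ⊗[R] T) (l : Module.Dual R F) :
    tensorEval R C F (f.lTensor C z) l = tensorEval R C T z (l ∘ₗ f) := by
  induction z with
  | zero => simp
  | tmul c t => rfl
  | add x y hx hy => simp [hx, hy]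

theorem tensorEval_surjective_of_free [Module.Free R F] [Module.Finite R F] :
    Function.Surjective (tensorEval R C F) := by
  intro φ
  let b := Module.Free.chooseBasis R F
  refine ⟨∑ j, φ (b.coord j) ⊗ₜ b j, LinearMap.ext fun l => ?_⟩
  rw [map_sum, LinearMap.sum_apply]
  simp only [tensorEval_tmul, ← map_smul, ← map_sum]
  congr 1
  exact b.sum_dual_apply_smul_coord l

/-- If `T` embeds into a free module `F` such that `Hom(F, R) → Hom(T, R)` is surjective and the
cokernel is separated by functionals after tensoring with `C`, then every map `T^* → C` is given
by an element of `C ⊗ T`. -/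
theorem tensorEval_surjective [Module.Free R F] [Module.Finite R F] {i : T →ₗ[R] F}
    (hd : Function.Surjective i.dualMap)
    (hsep : Function.Injective (tensorEval R C (F ⧸ LinearMap.range i))) :
    Function.Surjective (tensorEval R C T) := by
  intro φ
  -- The map `F^* → T^* → C` comes from some `b` in `C ⊗ F`. It kills functionals vanishing on `T`,
  -- so by `hsep` the image of `b` in `C ⊗ F/T` is zero and `b` lifts to `C ⊗ T`.
  obtain ⟨b, hb⟩ := tensorEval_surjective_of_free (C := C) (φ ∘ₗ i.dualMap)
  have hb' : (LinearMap.range i).mkQ.lTensor C b = 0 := by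
    apply hsep
    rw [map_zero]
    ext l
    rw [tensorEval_lTensor, hb, LinearMap.comp_apply]
    have : i.dualMap (l ∘ₗ (LinearMap.range i).mkQ) = 0 := by
      ext t
      have h0 : (LinearMap.range i).mkQ (i t) = 0 :=
        (Submodule.Quotient.mk_eq_zero _).2 ⟨t, rfl⟩
      change l ((LinearMap.range i).mkQ (i t)) = 0
      rw [h0, map_zero]
    rw [this]
    simp
  obtain ⟨z, rfl⟩ := (lTensor_exact C (LinearMap.exact_map_mkQ_range i)
    (Submodule.mkQ_surjective _) b).1 hb'
  refine ⟨z, LinearMap.ext fun l => ?_⟩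
  obtain ⟨l, rfl⟩ := hd l
  rw [← LinearMap.comp_apply φ, ← hb, tensorEval_lTensor]
  rfl

end Contraction

/-! ### Vanishing of `Ext` from dual modules -/

section Vanishing

variable {R : Type u} [CommRing R]

/-- Every module in the class embeds into a finitely generated free module, with cokernel in the
class and such that functionals extend. -/
def IsCosyzygyClosed (Q : ModuleCat.{u} R → Prop) : Prop :=
  ∀ T, Q T → ∃ (F : ModuleCat.{u} R) (i : T →ₗ[R] F), Module.Free R F ∧ Module.Finite R F ∧
      Function.Injective i ∧ Function.Surjective i.dualMap ∧
      Q (ModuleCat.of R (F ⧸ LinearMap.range i))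

theorem IsCosyzygyClosed.extVanish_dual {Q : ModuleCat.{u} R → Prop} (hQ : IsCosyzygyClosed Q)
    {C : Type u} [AddCommGroup C] [Module R C]
    (hsep : ∀ T, Q T → Function.Injective (tensorEval R C T)) (j : ℕ) (T : ModuleCat.{u} R)
    (hT : Q T) : ExtVanish R (Module.Dual R T) C (j + 1) := by
  induction j generalizing T with
  | zero =>
    obtain ⟨F, i, _, _, hi, hd, hT'⟩ := hQ T hT
    obtain ⟨F', i', _, _, hi', hd', hT''⟩ := hQ _ hT'
    refine ExtVanish.one_of_forall_extension (f := (LinearMap.range i).mkQ.dualMap)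
      (g := i.dualMap) (LinearMap.dualMap_injective_of_surjective (Submodule.mkQ_surjective _)) ?_ hd
      (ExtVanish.of_free 0) fun φ => ?_
    · exact LinearMap.exact_lcomp_of_exact_of_surjective R (LinearMap.exact_map_mkQ_range i)
        (Submodule.mkQ_surjective _)
    -- A map `(F/T)^* → C` is represented by an element of `C ⊗ F/T`, since the evaluation map of
    -- the second cosyzygy is injective; a lift to `C ⊗ F` extends it to `F^*`.
    · obtain ⟨z, rfl⟩ := tensorEval_surjective (C := C) hd' (hsep _ hT'') φ
      obtain ⟨e, rfl⟩ := LinearMap.lTensor_surjective C (Submodule.mkQ_surjective _) z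
      refine ⟨tensorEval R C F e, LinearMap.ext fun l => ?_⟩
      rw [tensorEval_lTensor]
      rfl
  | succ j ih =>
    obtain ⟨F, i, _, _, hi, hd, hT'⟩ := hQ T hT
    refine ExtVanish.right (f := (LinearMap.range i).mkQ.dualMap)
      (g := i.dualMap) (LinearMap.dualMap_injective_of_surjective (Submodule.mkQ_surjective _)) ?_ hd
      (ih _ hT') (ExtVanish.of_free _)
    exact LinearMap.exact_lcomp_of_exact_of_surjective R (LinearMap.exact_map_mkQ_range i)
      (Submodule.mkQ_surjective _)

theorem isCosyzygyClosed_isTotallyReflexive :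
    IsCosyzygyClosed fun T : ModuleCat.{u} R => IsTotallyReflexive R T :=
  fun _ hT => IsTotallyReflexive.exists_embedding hT

theorem tensorEval_self_injective {T F : Type*} [AddCommGroup T] [Module R T] [AddCommGroup F]
    [Module R F] [Module.Free R F] {i : T →ₗ[R] F} (hi : Function.Injective i) :
    Function.Injective (tensorEval R R T) := by
  rw [injective_iff_map_eq_zero]
  intro z hz
  apply (TensorProduct.lid R T).injective
  apply hi
  rw [map_zero, map_zero]
  refine (Module.forall_dual_apply_eq_zero_iff R _).1 fun l => ?_
  have h1 : ∀ z : R ⊗[R] T, tensorEval R R T z (l ∘ₗ i) = l (i (TensorProduct.lid R T z)) := by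
    intro z
    induction z with
    | zero => simp
    | tmul c t => simp [tensorEval_tmul, mul_comm]
    | add x y hx hy => simp [hx, hy]
  rw [← h1, hz]
  rfl

end Vanishing

/-! ### Modules on which powers factor through free modules -/

section PowersFactor

variable {R : Type u} [CommRing R] [IsLocalRing R]

open IsLocalRing

/-- For each `x` in the maximal ideal, multiplication by some power of `x` factors through a
finitely generated free module. -/
def PowersFactorThroughFree (R : Type u) [CommRing R] [IsLocalRing R] (T : Type u)
    [AddCommGroup T] [Module R T] : Prop :=
  ∀ x ∈ maximalIdeal R, ∃ (n : ℕ) (F : ModuleCat.{u} R) (a : T →ₗ[R] F) (b : F →ₗ[R] T),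
    Module.Free R F ∧ Module.Finite R F ∧ ∀ t, b (a t) = x ^ n • t

/-- Extend `a` to `a'` on `F`. The endomorphism `x^n - i b a'` of `F` kills `i(T)` and induces `x^n`
on the cokernel, which thus factors through `F`. -/
theorem PowersFactorThroughFree.coker {T F : Type u} [AddCommGroup T] [Module R T]
    [AddCommGroup F] [Module R F] [Module.Free R F] [Module.Finite R F] {i : T →ₗ[R] F}
    (hd : Function.Surjective i.dualMap) (h : PowersFactorThroughFree R T) :
    PowersFactorThroughFree R (F ⧸ LinearMap.range i) := by
  intro x hx
  obtain ⟨n, F₀, a, b, _, _, hab⟩ := h x hx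
  obtain ⟨a', ha'⟩ := exists_extension_to_free hd a
  have ha : ∀ t, a' (i t) = a t := LinearMap.congr_fun ha'
  let γ : F →ₗ[R] F := x ^ n • LinearMap.id - i ∘ₗ b ∘ₗ a'
  have hγ : ∀ f, γ f = x ^ n • f - i (b (a' f)) := fun f => rfl
  refine ⟨n, ModuleCat.of R F, (LinearMap.range i).liftQ γ ?_, (LinearMap.range i).mkQ,
    inferInstance, inferInstance, fun t => ?_⟩
  · rintro _ ⟨t, rfl⟩
    rw [LinearMap.mem_ker, hγ, ha, hab, map_smul, sub_self]
  · obtain ⟨f, rfl⟩ := Submodule.mkQ_surjective _ t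
    have h0 : (LinearMap.range i).mkQ (i (b (a' f))) = 0 :=
      (Submodule.Quotient.mk_eq_zero _).2 ⟨_, rfl⟩
    have : (LinearMap.range i).mkQ (γ f) = x ^ n • (LinearMap.range i).mkQ f := by
      rw [hγ, map_sub, map_smul, h0, sub_zero]
    exact this

theorem PowersFactorThroughFree.tensorEval_injective [IsNoetherianRing R] {C T : Type u}
    [AddCommGroup C] [Module R C] [AddCommGroup T] [Module R T]
    (h : PowersFactorThroughFree R T) (hC : ExtVanish R (ResidueField R) (C ⊗[R] T) 0) :
    Function.Injective (tensorEval R C T) := by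
  rw [injective_iff_map_eq_zero]
  intro z hz
  refine IsMaxTorsion.eq_zero_of_extVanish hC z fun x hx => ?_
  obtain ⟨n, F, a, b, _, _, hab⟩ := h x hx
  refine ⟨n, ?_⟩
  -- The coordinates of `a` are functionals on `T`, and contracting `z` with any of them gives zero.
  have h1 : a.lTensor C z = 0 := by
    let e := Module.Free.chooseBasis R F
    have h2 : a = ∑ j, (LinearMap.toSpanSingleton R F (e j)) ∘ₗ (e.coord j ∘ₗ a) := by
      ext t
      simp [e.sum_repr]
    have h3 : ∀ (l : Module.Dual R T) (f : F) (z : C ⊗[R] T),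
        (LinearMap.toSpanSingleton R F f ∘ₗ l).lTensor C z = tensorEval R C T z l ⊗ₜ f := by
      intro l f z
      induction z with
      | zero => simp
      | tmul c t => simp [tensorEval_tmul, smul_tmul]
      | add x y hx hy => rw [map_add, hx, hy, map_add, LinearMap.add_apply, add_tmul]
    rw [h2]
    have h4 : ∀ (s : Finset (Module.Free.ChooseBasisIndex R F)) (g : _ → T →ₗ[R] F),
        (∀ j, (g j).lTensor C z = 0) → (∑ j ∈ s, g j).lTensor C z = 0 := by
      intro s g hg
      rw [← LinearMap.coe_lTensorHom, map_sum, LinearMap.sum_apply]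
      exact Finset.sum_eq_zero fun j _ => hg j
    exact h4 _ _ fun j => by rw [h3, hz]; simp
  have h5 : b.lTensor C (a.lTensor C z) = x ^ n • z := by
    rw [← LinearMap.comp_apply, ← LinearMap.lTensor_comp]
    have : b ∘ₗ a = x ^ n • LinearMap.id := LinearMap.ext hab
    rw [this, LinearMap.lTensor_smul]
    simp
  rw [← h5, h1, map_zero]

end PowersFactor

/-! ### Free resolution with totally reflexive syzygies -/

section Resolution

variable {R : Type u} [CommRing R]

/-- A partial resolution of a complex `G` of totally reflexive modules: in degrees below `k` the
complex has been replaced by free modules (the last one being `E`), and in degree `k` by `W`. -/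
structure PartialResolution (G : ChainComplex (ModuleCat.{u} R) ℕ) (k : ℕ) where
  /-- The module in degree `k`. -/
  W : ModuleCat.{u} R
  /-- The free module in degree `k - 1`. -/
  E : ModuleCat.{u} R
  /-- The differential out of degree `k`. -/
  d : W →ₗ[R] E
  /-- The differential into degree `k`. -/
  δ : G.X (k + 1) →ₗ[R] W
  /-- The cycles of `G` as cycles of the new complex. -/
  j : LinearMap.ker (G.d k (k - 1)).hom →ₗ[R] W
  free : Module.Free R E
  finite : Module.Finite R E
  isTotallyReflexive : IsTotallyReflexive R W
  j_injective : Function.Injective j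
  d_eq_zero_iff : ∀ w, d w = 0 ↔ ∃ z, j z = w
  δ_eq : ∀ g (z : LinearMap.ker (G.d k (k - 1)).hom), (z : G.X k) = (G.d (k + 1) k).hom g → δ g = j z

namespace PartialResolution

variable {G : ChainComplex (ModuleCat.{u} R) ℕ}

/-- The trivial partial resolution. -/
def ofDegreeZero (h : IsTotallyReflexive R (G.X 0)) : PartialResolution G 0 where
  W := G.X 0
  E := ModuleCat.of R PUnit
  d := 0
  δ := (G.d 1 0).hom
  j := (LinearMap.ker (G.d 0 (0 - 1)).hom).subtype
  free := inferInstanceAs (Module.Free R PUnit.{u + 1})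
  finite := inferInstanceAs (Module.Finite R PUnit.{u + 1})
  isTotallyReflexive := h
  j_injective := Subtype.val_injective
  d_eq_zero_iff w := by
    refine ⟨fun _ => ⟨⟨w, ?_⟩, rfl⟩, fun _ => rfl⟩
    -- Truncated subtraction makes this `d 0 0`, which is zero, so all of `G_0` consists of cycles.
    rw [G.shape 0 (0 - 1) (by simp)]
    simp
  δ_eq g z hz := hz.symm

theorem d_comp_d_apply (k : ℕ) (g : G.X (k + 1 + 1)) :
    (G.d (k + 1) k).hom ((G.d (k + 1 + 1) (k + 1)).hom g) = 0 := by
  have := G.d_comp_d (k + 1 + 1) (k + 1) k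
  exact LinearMap.congr_fun (congrArg ModuleCat.Hom.hom this) g

theorem exists_next {k : ℕ} (S : PartialResolution G k) (h : IsTotallyReflexive R (G.X (k + 1))) :
    ∃ (S' : PartialResolution G (k + 1)) (π : S'.E →ₗ[R] S.W), Function.Surjective π ∧
      (∀ e, π e = 0 → ∃ w, S'.d w = e) ∧ ∀ w, (∃ w', π (S'.d w') = w) ↔ ∃ g, S.δ g = w := by
  obtain ⟨F, π, hF, hF', hπ, hK⟩ := S.isTotallyReflexive.exists_cover
  -- The pullback of `G_(k+1) → W_k ← F`. Its projection to `G_(k+1)` is onto with kernel `ker π`,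
  -- so it is totally reflexive as an extension.
  let W : Submodule R (G.X (k + 1) × F) :=
    LinearMap.eqLocus (S.δ ∘ₗ LinearMap.fst R _ _) (π ∘ₗ LinearMap.snd R _ _)
  have hW : ∀ y : G.X (k + 1) × F, y ∈ W ↔ S.δ y.1 = π y.2 := fun y => Iff.rfl
  have hδ : ∀ g, (G.d (k + 1) k).hom g = 0 → S.δ g = 0 := fun g hg => by
    rw [S.δ_eq g 0 hg.symm, map_zero]
  have hTR : IsTotallyReflexive R W := by
    refine IsTotallyReflexive.of_extension
      (f := ((LinearMap.inr R (G.X (k + 1)) F) ∘ₗ (LinearMap.ker π).subtype).codRestrict W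
        (fun e => ?_)) (g := (LinearMap.fst R (G.X (k + 1)) F) ∘ₗ W.subtype) hK h ?_ ?_ ?_
    · rw [hW]
      have : π e.1 = 0 := e.2
      simp [this]
    · intro a b hab
      have := congrArg (fun y : W => y.1.2) hab
      exact Subtype.ext this
    · rintro ⟨⟨a, b⟩, hab⟩
      constructor
      · intro ha
        have ha : a = 0 := ha
        subst ha
        have h2 := (hW _).1 hab
        exact ⟨⟨b, by rw [LinearMap.mem_ker, ← h2]; simp⟩, rfl⟩
      · rintro ⟨c, hc⟩
        rw [← hc]
        rfl
    · intro g
      obtain ⟨e, he⟩ := hπ (S.δ g)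
      exact ⟨⟨(g, e), he.symm⟩, rfl⟩
  let S' : PartialResolution G (k + 1) :=
    { W := ModuleCat.of R W
      E := F
      d := (LinearMap.snd R (G.X (k + 1)) F) ∘ₗ W.subtype
      δ := ((LinearMap.inl R (G.X (k + 1)) F) ∘ₗ (G.d (k + 1 + 1) (k + 1)).hom).codRestrict W
        (fun g => by
          rw [hW]
          simp [hδ _ (d_comp_d_apply k g)])
      j := ((LinearMap.inl R (G.X (k + 1)) F) ∘ₗ (LinearMap.ker _).subtype).codRestrict W
        (fun z => by
          rw [hW]
          have : S.δ z.1 = 0 := hδ _ z.2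
          simp [this])
      free := hF
      finite := hF'
      isTotallyReflexive := hTR
      j_injective := fun a b hab => Subtype.ext (congrArg (fun y : W => y.1.1) hab)
      d_eq_zero_iff := by
        rintro ⟨⟨a, b⟩, hab⟩
        constructor
        · intro hb
          have hb : b = 0 := hb
          subst hb
          have h2 : S.δ a = 0 := by
            have := (hW _).1 hab
            simpa using this
          have h3 : (G.d (k + 1) k).hom a = 0 := by
            have hz : (G.d (k + 1) k).hom a ∈ LinearMap.ker (G.d k (k - 1)).hom := by
              cases k with
              | zero =>
                rw [G.shape 0 (0 - 1) (by simp)]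
                simp
              | succ k => exact d_comp_d_apply k a
            rw [S.δ_eq a ⟨_, hz⟩ rfl] at h2
            exact congrArg Subtype.val (S.j_injective (h2.trans (map_zero _).symm))
          exact ⟨⟨a, h3⟩, rfl⟩
        · rintro ⟨z, hz⟩
          rw [← hz]
          rfl
      δ_eq := fun g z hz => Subtype.ext (Prod.ext hz.symm rfl) }
  refine ⟨S', π, hπ, fun e he => ⟨⟨(0, e), ?_⟩, rfl⟩, fun w => ⟨?_, ?_⟩⟩
  · rw [hW, he]
    simp
  · rintro ⟨⟨⟨a, b⟩, hab⟩, rfl⟩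
    exact ⟨a, hab⟩
  · rintro ⟨g, rfl⟩
    obtain ⟨e, he⟩ := hπ (S.δ g)
    exact ⟨⟨(g, e), he.symm⟩, he⟩

end PartialResolution

/-- A free resolution of a complex of totally reflexive modules, with its totally reflexive
syzygies `W k`. -/
theorem exists_free_resolution (G : ChainComplex (ModuleCat.{u} R) ℕ)
    (hG : ∀ i, IsTotallyReflexive R (G.X i)) :
    ∃ (W E : ℕ → ModuleCat.{u} R) (d : ∀ k, W k →ₗ[R] E k) (π : ∀ k, E (k + 1) →ₗ[R] W k),
      (∀ k, Module.Free R (E k)) ∧ (∀ k, Module.Finite R (E k)) ∧ Subsingleton (E 0) ∧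
      (∀ k, IsTotallyReflexive R (W k)) ∧ (∀ k, Function.Surjective (π k)) ∧
      (∀ k e, π k e = 0 → ∃ w, d (k + 1) w = e) ∧
      (∀ k w, d k (π k (d (k + 1) w)) = 0) ∧
      (∀ k (r : R), (∀ z, (G.d k (k - 1)).hom z = 0 → ∃ g, (G.d (k + 1) k).hom g = r • z) ↔
        ∀ w, d k w = 0 → ∃ w', π k (d (k + 1) w') = r • w) ∧
      (∀ k, Subsingleton (G.X (k + 1)) → ∀ w, π k (d (k + 1) w) = 0) := by
  choose next π hπ hker hrange using
    fun (k : ℕ) (S : PartialResolution G k) => S.exists_next (hG (k + 1))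
  let S : ∀ k, PartialResolution G k := fun k =>
    Nat.rec (PartialResolution.ofDegreeZero (hG 0)) (fun k S => next k S) k
  have hS : ∀ k, S (k + 1) = next k (S k) := fun k => rfl
  have hδ : ∀ k g, ∃ hz : (G.d (k + 1) k).hom g ∈ LinearMap.ker (G.d k (k - 1)).hom,
      (S k).δ g = (S k).j ⟨_, hz⟩ := by
    intro k g
    refine ⟨?_, (S k).δ_eq g _ rfl⟩
    cases k with
    | zero =>
      rw [G.shape 0 (0 - 1) (by simp)]
      simp
    | succ k => exact PartialResolution.d_comp_d_apply k g
  refine ⟨fun k => (S k).W, fun k => (S k).E, fun k => (S k).d, fun k => π k (S k),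
    fun k => (S k).free, fun k => (S k).finite, ?_, fun k => (S k).isTotallyReflexive,
    fun k => hπ k (S k), fun k => hker k (S k), ?_, ?_, ?_⟩
  · exact inferInstanceAs (Subsingleton PUnit.{u + 1})
  · intro k w
    obtain ⟨g, hg⟩ := (hrange k (S k) _).1 ⟨w, rfl⟩
    obtain ⟨hz, hg'⟩ := hδ k g
    exact ((S k).d_eq_zero_iff _).2 ⟨_, hg'.symm.trans hg⟩
  · intro k r
    constructor
    · intro h w hw
      obtain ⟨z, rfl⟩ := ((S k).d_eq_zero_iff w).1 hw
      obtain ⟨g, hg⟩ := h z.1 z.2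
      refine (hrange k (S k) _).2 ⟨g, ?_⟩
      rw [(S k).δ_eq g (r • z) hg.symm, map_smul]
    · intro h z hz
      obtain ⟨w', hw'⟩ := h ((S k).j ⟨z, hz⟩) (((S k).d_eq_zero_iff _).2 ⟨_, rfl⟩)
      obtain ⟨g, hg⟩ := (hrange k (S k) _).1 ⟨w', rfl⟩
      obtain ⟨hz', hg'⟩ := hδ k g
      refine ⟨g, congrArg Subtype.val (a₂ := r • ⟨z, hz⟩) ((S k).j_injective (hg'.symm.trans
        (hg.trans ?_)))⟩
      rw [map_smul]
      exact hw'
  · intro k hk w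
    obtain ⟨g, hg⟩ := (hrange k (S k) _).1 ⟨w, rfl⟩
    rw [Subsingleton.elim g 0, map_zero] at hg
    exact hg.symm

end Resolution

/-! ### Null-homotopies of powers -/

section Homotopy

variable {R : Type u} [CommRing R] {W E : ℕ → ModuleCat.{u} R} {d : ∀ k, W k →ₗ[R] E k}
  {π : ∀ k, E (k + 1) →ₗ[R] W k}

theorem exists_homotopy_succ [∀ k, Module.Free R (E k)] (hπ : ∀ k, Function.Surjective (π k))
    (hker : ∀ k e, π k e = 0 → ∃ w, d (k + 1) w = e) {x : R} {k : ℕ}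
    (htors : ∃ n : ℕ, ∀ w, d k w = 0 → ∃ w', π k (d (k + 1) w') = x ^ n • w)
    (h : ∃ (n : ℕ) (ρ : E k →ₗ[R] W k), ∀ w, d k (x ^ n • w - ρ (d k w)) = 0) :
    ∃ (n : ℕ) (σ : E k →ₗ[R] E (k + 1)) (ρ : E (k + 1) →ₗ[R] W (k + 1)),
      ∀ e, σ (d k (π k e)) + d (k + 1) (ρ e) = x ^ n • e := by
  obtain ⟨n', hn'⟩ := htors
  obtain ⟨n, ρ, hρ⟩ := h
  obtain ⟨σ, hσ⟩ := Module.projective_lifting_property (π k) (x ^ n' • ρ) (hπ k)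
  have hσ' : ∀ e, π k (σ e) = x ^ n' • ρ e := LinearMap.congr_fun hσ
  -- For each `e`, `x^n π e - ρ d π e` is a cycle, so `x^n'` times it is a boundary. Hence `v` lands
  -- in the image of `d (k + 1)` and lifts, `E (k + 1)` being free.
  let v : E (k + 1) →ₗ[R] E (k + 1) := x ^ (n' + n) • LinearMap.id - σ ∘ₗ d k ∘ₗ π k
  have hv : ∀ e, v e = x ^ (n' + n) • e - σ (d k (π k e)) := fun e => rfl
  have hv' : ∀ e, v e ∈ LinearMap.range (d (k + 1)) := by
    intro e
    obtain ⟨w', hw'⟩ := hn' _ (hρ (π k e))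
    obtain ⟨w'', hw''⟩ := hker k (v e - d (k + 1) w') (by
      rw [map_sub, hw', hv, map_sub, map_smul, hσ', pow_add, mul_smul, smul_sub, sub_self])
    exact ⟨w'' + w', by rw [map_add, hw'']; abel⟩
  obtain ⟨ρ', hρ'⟩ := Module.projective_lifting_property (d (k + 1)).rangeRestrict
    (v.codRestrict _ hv') (d (k + 1)).surjective_rangeRestrict
  refine ⟨n' + n, σ, ρ', fun e => ?_⟩
  have : d (k + 1) (ρ' e) = v e := congrArg Subtype.val (LinearMap.congr_fun hρ' e)
  rw [this, hv]
  abel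

theorem exists_homotopy [∀ k, Module.Free R (E k)] [Subsingleton (E 0)]
    (hπ : ∀ k, Function.Surjective (π k)) (hker : ∀ k e, π k e = 0 → ∃ w, d (k + 1) w = e)
    (hd : ∀ k w, d k (π k (d (k + 1) w)) = 0) {x : R} {s : ℕ}
    (htors : ∀ k < s, ∃ n : ℕ, ∀ w, d k w = 0 → ∃ w', π k (d (k + 1) w') = x ^ n • w) (k : ℕ)
    (hk : k ≤ s) :
    ∃ (n : ℕ) (ρ : E k →ₗ[R] W k), ∀ w, d k (x ^ n • w - ρ (d k w)) = 0 := by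
  induction k with
  | zero => exact ⟨0, 0, fun w => Subsingleton.elim _ _⟩
  | succ k ih =>
    obtain ⟨n, σ, ρ, h⟩ := exists_homotopy_succ hπ hker (htors k hk) (ih (by omega))
    refine ⟨n, ρ, fun w => ?_⟩
    rw [map_sub, map_smul, ← h, hd, map_zero, zero_add, sub_self]

end Homotopy

/-! ### Exactness of the dual complex -/

section DualComplex

theorem LinearMap.exact_subtype_ker_rangeRestrict {R M N : Type*} [CommRing R] [AddCommGroup M]
    [Module R M] [AddCommGroup N] [Module R N] (f : M →ₗ[R] N) :
    Function.Exact (LinearMap.ker f).subtype f.rangeRestrict := by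
  intro z
  rw [← LinearMap.mem_ker, LinearMap.ker_rangeRestrict]
  simp

variable {R : Type u} [CommRing R] {W E : ℕ → ModuleCat.{u} R} {d : ∀ k, W k →ₗ[R] E k}
  {π : ∀ k, E (k + 1) →ₗ[R] W k}

/-- The kernel of the dual map `E_k^* → W_k^*`. -/
def dualCycle (d : ∀ k, W k →ₗ[R] E k) (k : ℕ) : ModuleCat.{u} R :=
  ModuleCat.of R (LinearMap.ker (d k).dualMap)

/-- The image of the dual map `E_k^* → W_k^*`. -/
def dualBoundary (d : ∀ k, W k →ₗ[R] E k) (k : ℕ) : ModuleCat.{u} R :=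
  ModuleCat.of R (LinearMap.range (d k).dualMap)

/-- The surjection of `E_k^*` onto the image of `E_k^* → W_k^*`. -/
def toDualBoundary (d : ∀ k, W k →ₗ[R] E k) (k : ℕ) :
    Module.Dual R (E k) →ₗ[R] dualBoundary d k :=
  (d k).dualMap.rangeRestrict

theorem toDualBoundary_surjective (d : ∀ k, W k →ₗ[R] E k) (k : ℕ) :
    Function.Surjective (toDualBoundary d k) :=
  (d k).dualMap.surjective_rangeRestrict

/-- The embedding of the image of `E_k^* → W_k^*` into the kernel of `E_{k+1}^* → W_{k+1}^*`. -/
def boundaryToCycle (hd : ∀ k w, d k (π k (d (k + 1) w)) = 0) (k : ℕ) :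
    dualBoundary d k →ₗ[R] dualCycle d (k + 1) :=
  (π k).dualMap.restrict (p := LinearMap.range (d k).dualMap)
    (q := LinearMap.ker (d (k + 1)).dualMap) (by
    rintro _ ⟨l, rfl⟩
    ext w
    change l (d k (π k (d (k + 1) w))) = 0
    rw [hd, map_zero])

theorem boundaryToCycle_injective (hd : ∀ k w, d k (π k (d (k + 1) w)) = 0)
    (hπ : ∀ k, Function.Surjective (π k)) (k : ℕ) :
    Function.Injective (boundaryToCycle hd k) := fun _ _ hab =>
  Subtype.ext (LinearMap.dualMap_injective_of_surjective (hπ k) (congrArg Subtype.val hab))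

/-- Dualising the homotopy: the term through `d (k + 1)` vanishes on a dual cycle `φ`, so `x^n φ` is
the boundary coming from `φ ∘ σ`. -/
theorem isMaxTorsion_cycle_quotient [IsLocalRing R] (hd : ∀ k w, d k (π k (d (k + 1) w)) = 0) {k : ℕ}
    (h : ∀ x ∈ IsLocalRing.maximalIdeal R, ∃ (n : ℕ) (σ : E k →ₗ[R] E (k + 1))
      (ρ : E (k + 1) →ₗ[R] W (k + 1)), ∀ e, σ (d k (π k e)) + d (k + 1) (ρ e) = x ^ n • e) :
    IsMaxTorsion R (dualCycle d (k + 1) ⧸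
      LinearMap.range (boundaryToCycle hd k)) := by
  intro x hx z
  obtain ⟨z, rfl⟩ := Submodule.mkQ_surjective _ z
  obtain ⟨n, σ, ρ, hn⟩ := h x hx
  refine ⟨n, ?_⟩
  rw [← map_smul]
  obtain ⟨φ, hφ⟩ := z
  refine (Submodule.Quotient.mk_eq_zero _).2 ⟨⟨(d k).dualMap (φ ∘ₗ σ), ⟨_, rfl⟩⟩, Subtype.ext ?_⟩
  ext e
  have hφ' : φ (d (k + 1) (ρ e)) = 0 := LinearMap.congr_fun hφ _
  change φ (σ (d k (π k e))) = x ^ n • φ e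
  rw [← map_smul, ← hn, map_add, hφ', add_zero]

variable [∀ k, Module.Free R (E k)] [∀ k, Module.Finite R (E k)]

theorem extVanish_boundary_succ {N : Type u} [AddCommGroup N] [Module R N] {k i : ℕ}
    (h : ExtVanish R (dualCycle d (k + 1)) N i) :
    ExtVanish R (dualBoundary d (k + 1)) N (i + 1) :=
  ExtVanish.right (f := (LinearMap.ker (d (k + 1)).dualMap).subtype)
    (g := (d (k + 1)).dualMap.rangeRestrict) Subtype.val_injective
    (LinearMap.exact_subtype_ker_rangeRestrict _) (LinearMap.surjective_rangeRestrict _) h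
    (ExtVanish.of_free _)

theorem extVanish_cycle {N : Type u} [AddCommGroup N] [Module R N] {k : ℕ}
    (h : ∀ i, ExtVanish R (dualBoundary d (k + 1)) N (i + 1)) (i : ℕ) :
    ExtVanish R (dualCycle d (k + 1)) N (i + 1) :=
  ExtVanish.left (f := (LinearMap.ker (d (k + 1)).dualMap).subtype)
    (g := (d (k + 1)).dualMap.rangeRestrict) Subtype.val_injective
    (LinearMap.exact_subtype_ker_rangeRestrict _) (LinearMap.surjective_rangeRestrict _)
    (ExtVanish.of_free _) (h (i + 1))

variable [IsLocalRing R]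

open IsLocalRing

variable [IsNoetherianRing R]

instance (k : ℕ) : Module.Finite R (dualCycle d k) :=
  inferInstanceAs (Module.Finite R (LinearMap.ker (d k).dualMap))

/-- Each passage from `k` to `k + 1` adds a torsion homology module, harmless in degrees at most
`t`, then shifts degree by one through a free module; hence the range `k ≤ i ≤ t`. -/
theorem extVanish_boundary [Subsingleton (E 0)] (hd : ∀ k w, d k (π k (d (k + 1) w)) = 0)
    (hπ : ∀ k, Function.Surjective (π k)) {s : ℕ}
    (htors : ∀ k < s, IsMaxTorsion R (dualCycle d (k + 1) ⧸
      LinearMap.range (boundaryToCycle hd k)))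
    {N : Type u} [AddCommGroup N] [Module R N] {t : ℕ}
    (ht : ∀ j ≤ t, ExtVanish R (ResidueField R) N j) (k : ℕ) (hk : k ≤ s) (i : ℕ) (hki : k ≤ i)
    (hit : i ≤ t) : ExtVanish R (dualBoundary d k) N i := by
  induction k generalizing i with
  | zero =>
    have : Subsingleton (dualBoundary d 0) := by
      refine ⟨?_⟩
      rintro ⟨_, l, rfl⟩ ⟨_, l', rfl⟩
      rw [Subsingleton.elim l l']
    exact ExtVanish.of_subsingleton i
  | succ k ih =>
    obtain ⟨i, rfl⟩ : ∃ j, i = j + 1 := ⟨i - 1, by omega⟩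
    refine extVanish_boundary_succ ?_
    exact ExtVanish.middle (boundaryToCycle_injective hd hπ k) (LinearMap.exact_map_mkQ_range _)
      (Submodule.mkQ_surjective _) (ih (by omega) i (by omega) (by omega))
      (IsMaxTorsion.extVanish (fun j hj => ht j (by omega)) _ (htors k hk))

/-- Under the depth assumption, the dual complex is exact. -/
theorem dual_exact [Subsingleton (E 0)] (hd : ∀ k w, d k (π k (d (k + 1) w)) = 0)
    (hπ : ∀ k, Function.Surjective (π k)) {s : ℕ}
    (htors : ∀ k < s, IsMaxTorsion R (dualCycle d (k + 1) ⧸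
      LinearMap.range (boundaryToCycle hd k)))
    (htop : IsMaxTorsion R (Module.Dual R (W s) ⧸ LinearMap.range (d s).dualMap))
    {N : Type u} [AddCommGroup N] [Module R N] {t : ℕ} (hst : s ≤ t)
    (ht : ∀ j ≤ t, ExtVanish R (ResidueField R) N j)
    (ht' : ¬ ExtVanish R (ResidueField R) N (t + 1))
    (hN : ∀ i, ExtVanish R (Module.Dual R (W s)) N (i + 1))
    (hR : ∀ i, ExtVanish R (Module.Dual R (W s)) R (i + 1)) :
    Function.Surjective (d s).dualMap ∧
      (∀ k < s, Function.Surjective (boundaryToCycle hd k)) ∧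
      ∀ k ≤ s, ∀ i, ExtVanish R (dualBoundary d k) R (i + 1) := by
  have hbd := extVanish_boundary hd hπ htors ht
  have hfin : Module.Finite R (Module.Dual R (W s)) :=
    Module.Finite.of_injective (π s).dualMap (LinearMap.dualMap_injective_of_surjective (hπ s))
  have hsurj : Function.Surjective (d s).dualMap := by
    -- This is where `s ≤ t` enters: `Ext^t` of the boundaries must vanish for `Ext^(t+1)` of the
    -- cokernel to embed in that of `W_s^*`.
    have := htop.subsingleton_of_extVanish ht ht' (ExtVanish.right
      (f := (LinearMap.range (d s).dualMap).subtype) (g := (LinearMap.range (d s).dualMap).mkQ)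
      Subtype.val_injective (LinearMap.exact_subtype_mkQ _) (Submodule.mkQ_surjective _)
      (hbd s le_rfl t hst le_rfl) (hN t))
    rw [← LinearMap.range_eq_top]
    exact Submodule.Quotient.subsingleton_iff.1 this
  have hstep : ∀ k < s, (∀ i, ExtVanish R (dualBoundary d (k + 1)) N (i + 1)) →
      Function.Surjective (boundaryToCycle hd k) := by
    intro k hk h
    have := (htors k hk).subsingleton_of_extVanish ht ht' (ExtVanish.right
      (boundaryToCycle_injective hd hπ k) (LinearMap.exact_map_mkQ_range _)
      (Submodule.mkQ_surjective _) (hbd k hk.le t (by omega) le_rfl) (extVanish_cycle h t))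
    rw [← LinearMap.range_eq_top]
    exact Submodule.Quotient.subsingleton_iff.1 this
  -- Descend from the top: boundaries in position `s` are all of `W_s^*`, and once homology vanishes
  -- at `k + 1`, boundaries at `k` are cycles at `k + 1`.
  have hall : ∀ k ≤ s, (∀ i, ExtVanish R (dualBoundary d k) N (i + 1)) ∧
      ∀ i, ExtVanish R (dualBoundary d k) R (i + 1) := by
    intro k hk
    induction hk using Nat.decreasingInduction with
    | self =>
      let e : Module.Dual R (W s) ≃ₗ[R] dualBoundary d s :=
        (LinearEquiv.ofTop _ (LinearMap.range_eq_top.2 hsurj)).symm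
      exact ⟨fun i => (hN i).congr_left e, fun i => (hR i).congr_left e⟩
    | of_succ k hk ih =>
      let e := (LinearEquiv.ofBijective _
        ⟨boundaryToCycle_injective hd hπ k, hstep k hk ih.1⟩).symm
      exact ⟨fun i => (extVanish_cycle ih.1 i).congr_left e,
        fun i => (extVanish_cycle ih.2 i).congr_left e⟩
  exact ⟨hsurj, fun k hk => hstep k hk (hall (k + 1) hk).1, fun k hk => (hall k hk).2⟩

end DualComplex

/-! ### Dualising back -/

section Bidual

variable {R : Type u} [CommRing R] {W E : ℕ → ModuleCat.{u} R} {d : ∀ k, W k →ₗ[R] E k}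
  {π : ∀ k, E (k + 1) →ₗ[R] W k} [∀ k, Module.Free R (E k)] [∀ k, Module.Finite R (E k)]

theorem exact_of_dual_exact (hd : ∀ k w, d k (π k (d (k + 1) w)) = 0)
    (hπ : ∀ k, Function.Surjective (π k)) {s : ℕ}
    (hsurj : Function.Surjective (d s).dualMap)
    (hex : ∀ k < s, Function.Surjective (boundaryToCycle hd k))
    (hR : ∀ k ≤ s, ∀ i, ExtVanish R (dualBoundary d k) R (i + 1))
    (hrefl : Function.Bijective (Module.Dual.eval R (W s))) (k : ℕ) (hk : k ≤ s) (w : W k)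
    (hw : d k w = 0) : ∃ w', π k (d (k + 1) w') = w := by
  obtain rfl | hk := hk.eq_or_lt
  · refine ⟨0, ?_⟩
    rw [map_zero, map_zero]
    symm
    apply hrefl.1
    rw [map_zero]
    ext l
    obtain ⟨l, rfl⟩ := hsurj l
    change l (d k w) = 0
    rw [hw, map_zero]
  obtain ⟨e, rfl⟩ := hπ k w
  -- Evaluation at `e` kills the dual cycles, since these are boundaries and `d k w = 0`; it
  -- therefore descends to a functional `θ` on boundaries, to be realised by an element of `W (k +
  -- 1)`.
  obtain ⟨θ, hθ⟩ := LinearMap.exists_comp_eq_of_surjective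
    (toDualBoundary_surjective d (k + 1)) (Module.Dual.eval R (E (k + 1)) e)
    (fun l hl => by
      obtain ⟨⟨_, m, rfl⟩, hm⟩ := hex k hk ⟨l, LinearMap.mem_ker.2 (congrArg Subtype.val hl)⟩
      have hm : (π k).dualMap ((d k).dualMap m) = l := congrArg Subtype.val hm
      rw [← hm]
      change m (d k (π k e)) = 0
      rw [hw, map_zero])
  have hθ' : ∀ l, θ (toDualBoundary d (k + 1) l) = l e := LinearMap.congr_fun hθ
  suffices h : ∃ w', ∀ m, θ m = m.1 w' by
    obtain ⟨w', hw'⟩ := h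
    refine ⟨w', congrArg _ ?_⟩
    rw [← sub_eq_zero]
    refine (Module.forall_dual_apply_eq_zero_iff R _).1 fun l => ?_
    rw [map_sub, ← hθ', hw', sub_eq_zero]
    rfl
  obtain rfl | hk' := (show k + 1 ≤ s from hk).eq_or_lt
  · obtain ⟨w', hw'⟩ := hrefl.2
      (θ ∘ₗ (LinearEquiv.ofTop _ (LinearMap.range_eq_top.2 hsurj)).symm.toLinearMap)
    refine ⟨w', fun m => ?_⟩
    exact (LinearMap.congr_fun hw' m.1).symm
  -- Below the top, boundaries at `k + 1` are cycles in `E_(k+2)^*`. Vanishing of `Ext^1` extends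
  -- `θ` to that dual, where it is evaluation at some `e'`.
  · obtain ⟨ψ, hψ⟩ := ExtVanish.exists_extension
      (f := (LinearMap.ker (d (k + 1 + 1)).dualMap).subtype)
      (g := (d (k + 1 + 1)).dualMap.rangeRestrict) Subtype.val_injective
      (LinearMap.exact_subtype_ker_rangeRestrict _) (LinearMap.surjective_rangeRestrict _)
      (hR (k + 1 + 1) hk' 0) (θ ∘ₗ (LinearEquiv.ofBijective _
        ⟨boundaryToCycle_injective hd hπ (k + 1), hex (k + 1) hk'⟩).symm.toLinearMap)
    obtain ⟨e', rfl⟩ := (Module.bijective_dual_eval R (E (k + 1 + 1))).2 ψ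
    refine ⟨π (k + 1) e', fun m => ?_⟩
    have := LinearMap.congr_fun hψ (boundaryToCycle hd (k + 1) m)
    have h2 := LinearEquiv.ofBijective_symm_apply_apply (boundaryToCycle hd (k + 1))
      (h := ⟨boundaryToCycle_injective hd hπ (k + 1), hex (k + 1) hk'⟩) m
    exact (this.trans (congrArg θ h2)).symm

end Bidual

/-! ### Depth in terms of vanishing of `Ext` -/

section Depth

open IsLocalRing

variable {R : Type u} [CommRing R] [IsLocalRing R]

theorem extVanish_of_lt_moduleDepth {M : Type u} [AddCommGroup M] [Module R M] {n : ℕ}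
    (h : (n : ℕ∞) < moduleDepth R M) (j : ℕ) (hj : j ≤ n) :
    ExtVanish R (ResidueField R) M j := by
  by_contra hne
  have hne' : Nontrivial (Abelian.Ext (ModuleCat.of R (ResidueField R)) (ModuleCat.of R M) j) :=
    not_subsingleton_iff_nontrivial.1 hne
  have h1 : moduleDepth R M ≤ j := iInf₂_le j hne'
  exact absurd (h.trans_le h1) (by exact_mod_cast not_lt.2 hj)

theorem exists_minimal_not_extVanish {M : Type u} [AddCommGroup M] [Module R M]
    (h : moduleDepth R M < ⊤) : ∃ t, ¬ ExtVanish R (ResidueField R) M t ∧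
      ∀ j < t, ExtVanish R (ResidueField R) M j := by
  classical
  have hex : ∃ t, ¬ ExtVanish R (ResidueField R) M t := by
    by_contra! hall
    refine h.ne ?_
    unfold moduleDepth
    refine iInf₂_eq_top.2 fun i hi => ?_
    exact absurd (hall i) (not_subsingleton_iff_nontrivial.2 hi)
  exact ⟨Nat.find hex, Nat.find_spec hex, fun j hj => not_not.1 (Nat.find_min hex hj)⟩

end Depth

/-! ### Reflexivity, homology and the main argument -/

section Main

open IsLocalRing

theorem IsTotallyReflexive.bijective_dual_eval {R : Type u} [CommRing R] {T : Type u}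
    [AddCommGroup T] [Module R T] (hT : IsTotallyReflexive R T) :
    Function.Bijective (Module.Dual.eval R T) := by
  obtain ⟨F, i, _, _, hi, hd, hC⟩ := hT.exists_embedding
  obtain ⟨F', i', _, _, hi', -, -⟩ := hC.exists_embedding
  constructor
  · rw [injective_iff_map_eq_zero]
    intro t ht
    apply hi
    rw [map_zero]
    exact (Module.forall_dual_apply_eq_zero_iff R _).1 fun l => LinearMap.congr_fun ht (l ∘ₗ i)
  · intro φ
    obtain ⟨z, rfl⟩ := tensorEval_surjective (C := R) hd (tensorEval_self_injective hi') φ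
    refine ⟨TensorProduct.lid R T z, LinearMap.ext fun l => ?_⟩
    induction z with
    | zero => simp
    | tmul c t => simp [tensorEval_tmul, mul_comm]
    | add x y hx hy => rw [map_add, map_add, map_add, LinearMap.add_apply, hx, hy]; rfl

variable {R : Type u} [CommRing R]

theorem exists_boundary_of_smul_homology_eq_zero (G : ChainComplex (ModuleCat.{u} R) ℕ) (k : ℕ)
    (r : R) (hr : ∀ h : G.homology k, r • h = 0) (z : G.X k)
    (hz : (G.d k (k - 1)).hom z = 0) : ∃ g, (G.d (k + 1) k).hom g = r • z := by
  have hnext : (ComplexShape.down ℕ).next k = k - 1 := by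
    cases k with
    | zero => exact ChainComplex.next_nat_zero
    | succ k => exact ChainComplex.next_nat_succ k
  let S := G.sc' (k + 1) k (k - 1)
  let e : G.homology k ≅ S.moduleCatLeftHomologyData.H :=
    G.homologyIsoSc' (k + 1) k (k - 1) (by simp) hnext ≪≫ S.moduleCatHomologyIso
  have he : ∀ h : S.moduleCatLeftHomologyData.H, r • h = 0 := fun h => by
    have := congrArg e.hom.hom (hr (e.inv.hom h))
    rw [map_smul, map_zero] at this
    simpa using this
  have h1 : (Submodule.Quotient.mk (r • ⟨z, hz⟩ : LinearMap.ker S.g.hom) :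
      LinearMap.ker S.g.hom ⧸ LinearMap.range S.moduleCatToCycles) = 0 :=
    he (Submodule.Quotient.mk ⟨z, hz⟩)
  obtain ⟨g, hg⟩ := (Submodule.Quotient.mk_eq_zero _).1 h1
  exact ⟨g, congrArg Subtype.val hg⟩

theorem acyclic_of_exists_boundary (G : ChainComplex (ModuleCat.{u} R) ℕ)
    (h : ∀ k z, (G.d k (k - 1)).hom z = 0 → ∃ g, (G.d (k + 1) k).hom g = z) : G.Acyclic := by
  intro k
  have hnext : (ComplexShape.down ℕ).next k = k - 1 := by
    cases k with
    | zero => exact ChainComplex.next_nat_zero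
    | succ k => exact ChainComplex.next_nat_succ k
  rw [HomologicalComplex.exactAt_iff' G (k + 1) k (k - 1) (by simp) hnext,
    ShortComplex.moduleCat_exact_iff]
  exact h k

theorem IsTotallyReflexive.extVanish_residueField [IsLocalRing R] {T : Type u}
    [AddCommGroup T] [Module R T]
    (hT : IsTotallyReflexive R T) (h : ExtVanish R (ResidueField R) R 0) :
    ExtVanish R (ResidueField R) T 0 := by
  rw [ExtVanish.zero_iff] at h ⊢
  intro φ
  obtain ⟨F, i, _, _, hi, -, -⟩ := hT.exists_embedding
  ext
  apply hi
  rw [LinearMap.zero_apply, map_zero]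
  exact (Module.forall_dual_apply_eq_zero_iff R _).1 fun l =>
    LinearMap.congr_fun (h (l ∘ₗ i ∘ₗ φ)) _

variable [IsLocalRing R] [IsNoetherianRing R]

theorem acyclic_of_depth (s t : ℕ) (hst : s ≤ t) (G : ChainComplex (ModuleCat.{u} R) ℕ)
    (hG_zero : ∀ i, s < i → Subsingleton (G.X i)) (hG : ∀ i, IsTotallyReflexive R (G.X i))
    (hG_length : ∀ i, IsFiniteLength R (G.homology i))
    (B : Type u) [AddCommGroup B] [Module R B]
    (ht : ∀ j ≤ t, ExtVanish R (ResidueField R) B j)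
    (ht' : ¬ ExtVanish R (ResidueField R) B (t + 1))
    (hB : ∀ T : ModuleCat.{u} R, IsTotallyReflexive R T →
      ExtVanish R (ResidueField R) (B ⊗[R] T) 0) : G.Acyclic := by
  obtain ⟨W, E, d, π, hfree, hfin, hE, hW, hπ, hker, hd, hcompare, hzero⟩ :=
    exists_free_resolution G hG
  have htors : ∀ x ∈ maximalIdeal R, ∀ k,
      ∃ n : ℕ, ∀ w, d k w = 0 → ∃ w', π k (d (k + 1) w') = x ^ n • w := by
    intro x hx k
    obtain ⟨n, hn⟩ := (hG_length k).exists_pow_smul_eq_zero hx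
    exact ⟨n, (hcompare k _).1 (exists_boundary_of_smul_homology_eq_zero G k _ hn)⟩
  have hhom : ∀ x ∈ maximalIdeal R, ∀ k, ∃ (n : ℕ) (ρ : E k →ₗ[R] W k),
      ∀ w, d k (x ^ n • w - ρ (d k w)) = 0 := fun x hx k =>
    exists_homotopy hπ hker hd (fun k _ => htors x hx k) k le_rfl
  have htop : ∀ x ∈ maximalIdeal R, ∃ (n : ℕ) (ρ : E s →ₗ[R] W s),
      ∀ w, ρ (d s w) = x ^ n • w := by
    intro x hx
    obtain ⟨n, ρ, hρ⟩ := hhom x hx s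
    obtain ⟨n', hn'⟩ := htors x hx s
    refine ⟨n' + n, x ^ n' • ρ, fun w => ?_⟩
    obtain ⟨w', hw'⟩ := hn' _ (hρ w)
    -- As `G_(s+1) = 0`, the boundaries in `W_s` vanish, so the homotopy identity modulo boundaries
    -- becomes an equality.
    rw [hzero s (hG_zero _ (Nat.lt_succ_self s)), smul_sub, eq_comm, sub_eq_zero] at hw'
    rw [pow_add, mul_smul, hw']
    rfl
  have hPF : PowersFactorThroughFree R (W s) := by
    intro x hx
    obtain ⟨n, ρ, hρ⟩ := htop x hx
    exact ⟨n, E s, d s, ρ, inferInstance, inferInstance, hρ⟩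
  have hN : ∀ i, ExtVanish R (Module.Dual R (W s)) B (i + 1) := fun i =>
    IsCosyzygyClosed.extVanish_dual
      (Q := fun T : ModuleCat.{u} R => IsTotallyReflexive R T ∧ PowersFactorThroughFree R T)
      (fun T hT => by
        obtain ⟨F, j, h1, h2, h3, h4, h5⟩ := hT.1.exists_embedding
        exact ⟨F, j, h1, h2, h3, h4, h5, hT.2.coker h4⟩)
      (fun T hT => hT.2.tensorEval_injective (hB T hT.1)) i (W s) ⟨hW s, hPF⟩
  have hR : ∀ i, ExtVanish R (Module.Dual R (W s)) R (i + 1) := fun i =>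
    isCosyzygyClosed_isTotallyReflexive.extVanish_dual
      (fun T hT => by
        obtain ⟨F, j, h1, h2, h3, h4, h5⟩ := IsTotallyReflexive.exists_embedding hT
        exact tensorEval_self_injective h3) i (W s) (hW s)
  have hquot : IsMaxTorsion R (Module.Dual R (W s) ⧸ LinearMap.range (d s).dualMap) := by
    intro x hx φ
    obtain ⟨φ, rfl⟩ := Submodule.mkQ_surjective _ φ
    obtain ⟨n, ρ, hρ⟩ := htop x hx
    refine ⟨n, ?_⟩
    rw [← map_smul]
    refine (Submodule.Quotient.mk_eq_zero _).2 ⟨φ ∘ₗ ρ, LinearMap.ext fun w => ?_⟩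
    change φ (ρ (d s w)) = x ^ n • φ w
    rw [hρ, map_smul]
  obtain ⟨h1, h2, h3⟩ := dual_exact hd hπ
    (fun k _ => isMaxTorsion_cycle_quotient hd fun x hx =>
      exists_homotopy_succ hπ hker (htors x hx k) (hhom x hx k)) hquot hst ht ht' hN hR
  have hexact := exact_of_dual_exact hd hπ h1 h2 h3 (hW s).bijective_dual_eval
  refine acyclic_of_exists_boundary G fun k z hz => ?_
  obtain hk | hk := le_or_gt k s
  · obtain ⟨g, hg⟩ := (hcompare k 1).2 (fun w hw => by
      rw [one_smul]
      exact hexact k hk w hw) z hz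
    exact ⟨g, hg.trans (one_smul R z)⟩
  · have := hG_zero k hk
    exact ⟨0, Subsingleton.elim _ _⟩

end Main

theorem theorem3p3 (R : Type u) [CommRing R] [IsLocalRing R] [IsNoetherianRing R]
    (s : ℕ) (G : ChainComplex (ModuleCat.{u} R) ℕ)
    (hG_zero : ∀ i, s < i → Limits.IsZero (G.X i))
    (hG_refl : ∀ i, i ≤ s → IsTotallyReflexive R (G.X i))
    (hG_length : ∀ i, IsFiniteLength R (G.homology i))
    (hG_nonexact : ¬ G.Acyclic)
    (h : (∃ B : ModuleCat.{u} R, moduleDepth R B < ⊤ ∧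
            ∀ T : ModuleCat.{u} R, IsTotallyReflexive R T →
              ringKrullDim R ≤ ((moduleDepth R (B ⊗[R] T) : ℕ∞) : WithBot ℕ∞)) ∨
          IsCohenMacaulayLocal R) :
    ringKrullDim R ≤ (s : WithBot ℕ∞) := by
  by_contra hdim
  rw [not_le] at hdim
  have hlt : ∀ {n : ℕ∞}, ringKrullDim R ≤ (n : WithBot ℕ∞) → (s : ℕ∞) < n := fun hn => by
    have := hdim.trans_le hn
    exact_mod_cast this
  have hzero : ∀ i, s < i → Subsingleton (G.X i) := fun i hi =>
    ModuleCat.subsingleton_of_isZero (hG_zero i hi)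
  have hrefl : ∀ i, IsTotallyReflexive R (G.X i) := fun i => by
    obtain hi | hi := le_or_gt i s
    · exact hG_refl i hi
    · have := hzero i hi
      exact isTotallyReflexive_of_free (G.X i)
  obtain ⟨B, hB, hB', hB''⟩ : ∃ B : ModuleCat.{u} R, moduleDepth R B < ⊤ ∧
      (∀ j ≤ s, ExtVanish R (IsLocalRing.ResidueField R) B j) ∧
      ∀ T : ModuleCat.{u} R, IsTotallyReflexive R T →
        ExtVanish R (IsLocalRing.ResidueField R) (B ⊗[R] T) 0 := by
    rcases h with ⟨B, hB, h⟩ | h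
    · refine ⟨B, hB, fun j hj => ?_, fun T hT => ?_⟩
      -- The case `T = R` bounds the depth of `B` itself.
      · exact (extVanish_of_lt_moduleDepth
          (hlt (h (ModuleCat.of R R) (isTotallyReflexive_of_free _))) j hj).congr_right
          (TensorProduct.rid R B)
      · exact extVanish_of_lt_moduleDepth (hlt (h T hT)) 0 (Nat.zero_le _)
    · have hR := extVanish_of_lt_moduleDepth (hlt h.ge)
      refine ⟨ModuleCat.of R R, ?_, hR, fun T hT => ?_⟩
      · have h2 : ((moduleDepth R R : ℕ∞) : WithBot ℕ∞) < ⊤ := by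
          rw [h]
          exact ringKrullDim_lt_top
        rw [← WithBot.coe_top, WithBot.coe_lt_coe] at h2
        exact h2
      · exact (IsTotallyReflexive.extVanish_residueField hT (hR 0 (Nat.zero_le _))).congr_right
          (TensorProduct.lid R T).symm
  obtain ⟨t, ht, ht'⟩ := exists_minimal_not_extVanish hB
  have hst : s < t := by
    by_contra hle
    exact ht (hB' t (not_lt.1 hle))
  obtain ⟨t, rfl⟩ : ∃ t', t = t' + 1 := ⟨t - 1, by omega⟩
  exact hG_nonexact (acyclic_of_depth s t (by omega) G hzero hrefl hG_length B
    (fun j hj => ht' j (by omega)) ht hB'')
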